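/- Let $D\ge 2$ be an integer, $p>1$ and $\kappa\ge 2$ real. For an open, bounded, convex nonempty set $\Omega\subset\mathbb{R}^D$ let $|\Omega|$ be its Lebesgue measure, $P(\Omega)$ its perimeter (the $(D-1)$-dimensional surface measure of $\partial\Omega$) and $R_\Omega$ its inradius. Let $u_p\in W_0^{1,p}(\Omega)$ be the $p$-torsion function of $\Omega$, that is, the unique weak solution of $-\operatorname{div}(|\nabla u|^{p-2}\nabla u)=1$ in $\Omega$, $u=0$ on $\partial\Omega$, and put $$T_p(\Omega)=\int_\Omega u_p\,dx,\qquad T(p;\Omega)=|\Omega|^{p-1}T_p(\Omega)^{1-p},\qquad Q_p(\Omega)=\left(\frac{T(p;\Omega)\,R_\Omega^{\,p}}{\left(\frac{2p-1}{p-1}\right)^{p-1}}\right)^{1/p}.$$ For a family $\mathcal F$ of such sets put $$\gamma_{\mathcal F}(p)=\frac{\inf_{\Omega\in\mathcal F}Q_p(\Omega)}{\sup_{\Omega\in\mathcal F}Q_p(\Omega)}.$$ Let $\mathcal O_\kappa$ be the family of all boxes $\Omega=\prod_{i=1}^D(0,\ell_i)$ with $\ell_1=2R$ and $\ell_j\ge\kappa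 R$ for $j=2,\dots,D$, where $R$ ranges over all positive reals. Then every such box has inradius $R$ and finite perimeter, and satisfies $$\frac{R\,P(\Omega)}{|\Omega|}\le 1+\frac{2(D-1)}{\kappa}.$$ Moreover $$\gamma_{\mathcal O_\kappa}(p)\ \ge\ \frac{\kappa}{\kappa+2(D-1)}.$$ -/

import Mathlib

open MeasureTheory Filter Topology
open scoped ENNReal ContDiff

noncomputable section

namespace Torsion

/-- `ℝ^D` with its Euclidean norm. -/
abbrev E (D : ℕ) : Type := EuclideanSpace ℝ (Fin D)

variable {D : ℕ}

/-- `φ ∈ C_c^∞(Ω)`. -/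
def IsTestFunction (Ω : Set (E D)) (φ : E D → ℝ) : Prop :=
  ContDiff ℝ ∞ φ ∧ HasCompactSupport φ ∧ tsupport φ ⊆ Ω

/-- `u ∈ W_0^{1,p}(Ω)` with gradient `g`: `u` and `g` are in `L^p(Ω)` and `u` is a limit of functions
of `C_c^∞(Ω)` in the `W^{1,p}`-norm, the gradients converging to `g` in `L^p(Ω)`. (Integrating by
parts and passing to the limit, `g` is then the weak gradient of `u`.) -/
def IsSobolevZero (p : ℝ) (Ω : Set (E D)) (u : E D → ℝ) (g : E D → E D) : Prop :=
  MemLp u (ENNReal.ofReal p) (volume.restrict Ω) ∧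
  MemLp g (ENNReal.ofReal p) (volume.restrict Ω) ∧
  ∃ φ : ℕ → E D → ℝ, (∀ n, IsTestFunction Ω (φ n)) ∧
    Tendsto (fun n => eLpNorm (fun x => φ n x - u x) (ENNReal.ofReal p) (volume.restrict Ω))
      atTop (𝓝 0) ∧
    Tendsto (fun n => eLpNorm (fun x => gradient (φ n) x - g x) (ENNReal.ofReal p)
      (volume.restrict Ω)) atTop (𝓝 0)

/-- `u` is a weak solution in `W_0^{1,p}(Ω)` of `-div(|∇u|^{p-2} ∇u) = 1` in `Ω`, `u = 0` on `∂Ω`.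
(Where `g x = 0` the flux `‖g x‖^{p-2} g x` is `0`, also for `p < 2`.) -/
def IsTorsionFunction (p : ℝ) (Ω : Set (E D)) (u : E D → ℝ) : Prop :=
  ∃ g : E D → E D, IsSobolevZero p Ω u g ∧
    ∀ φ : E D → ℝ, IsTestFunction Ω φ →
      ∫ x in Ω, ‖g x‖ ^ (p - 2) * inner ℝ (g x) (gradient φ x) = ∫ x in Ω, φ x

/-- The `p`-torsion function `u_p` of `Ω` (for an open bounded convex set it exists and is unique
up to equality almost everywhere in `Ω`). -/
def torsionFunction (p : ℝ) (Ω : Set (E D)) : E D → ℝ :=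
  Classical.epsilon (IsTorsionFunction p Ω)

/-- The `p`-torsional rigidity `T_p(Ω) = ∫_Ω u_p dx`. -/
def torsionalRigidity (p : ℝ) (Ω : Set (E D)) : ℝ :=
  ∫ x in Ω, torsionFunction p Ω x

/-- The normalized `p`-torsional rigidity `T(p;Ω) = |Ω|^{p-1} T_p(Ω)^{1-p}`. -/
def normalizedRigidity (p : ℝ) (Ω : Set (E D)) : ℝ :=
  volume.real Ω ^ (p - 1) * torsionalRigidity p Ω ^ (1 - p)

/-- The inradius `R_Ω`: the supremum of the radii of the balls contained in `Ω`. -/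
def inradius (Ω : Set (E D)) : ℝ :=
  sSup {r : ℝ | 0 < r ∧ ∃ x : E D, Metric.ball x r ⊆ Ω}

/-- The perimeter `P(Ω)`: the surface measure of `∂Ω`, that is its `(D-1)`-dimensional Hausdorff
measure, normalized to agree with Lebesgue measure on `ℝ^{D-1}`. -/
def perimeter (Ω : Set (E D)) : ℝ≥0∞ :=
  Measure.euclideanHausdorffMeasure (D - 1) (frontier Ω)

/-- `Q_p(Ω) = (T(p;Ω) R_Ω^p / ((2p-1)/(p-1))^{p-1})^{1/p}`. -/
def Q (p : ℝ) (Ω : Set (E D)) : ℝ :=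
  (normalizedRigidity p Ω * inradius Ω ^ p / ((2 * p - 1) / (p - 1)) ^ (p - 1)) ^ (1 / p)

/-- `γ_F(p) = inf_{Ω ∈ F} Q_p(Ω) / sup_{Ω ∈ F} Q_p(Ω)`. (If `Q_p` were unbounded above on `F`, then
the real-valued supremum, and with it this quotient, would be `0`; so a positive lower bound on the
quotient contains the finiteness of the supremum.) -/
def gammaFamily (F : Set (Set (E D))) (p : ℝ) : ℝ :=
  sInf (Q p '' F) / sSup (Q p '' F)

/-- The open box `∏ (0, ℓ_i)`. -/
def box (l : Fin D → ℝ) : Set (E D) :=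
  {x | ∀ i, 0 < x i ∧ x i < l i}

/-- The first side is `2R`, every other side is at least `κR`. -/
def IsSides (κ R : ℝ) (l : Fin D → ℝ) : Prop :=
  0 < R ∧ (∀ i : Fin D, i.val = 0 → l i = 2 * R) ∧ (∀ i : Fin D, i.val ≠ 0 → κ * R ≤ l i)

/-- The family `O_κ` of orthotopes in `ℝ^D`. -/
def orthotopes (D : ℕ) (κ : ℝ) : Set (Set (E D)) :=
  {Ω | ∃ (R : ℝ) (l : Fin D → ℝ), IsSides κ R l ∧ Ω = box l}

end Torsion

end

noncomputable section

namespace Torsion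

variable {D : ℕ}


/-! Write `V` for the volume of a box, `q = p/(p-1)`, `M = ∑ 2R/l_i` and `T` for the torsional
rigidity. Since `(2p-1)/(p-1) = q+1`, one has `Q^p = (V R^q / ((q+1) T))^(p-1)`. Everything follows
from the two-sided bound `M^(-q) V R^q/(q+1) ≤ T ≤ V R^q/(q+1)`: because `q (p-1) = p` it reads `1 ≤
Q ≤ M`, and `M ≤ 1 + 2(D-1)/κ` because the short side contributes `1` to `M` and every other side at
most `2/κ`. The same sum bounds `R P/V`, since the two faces orthogonal to `e_i` have total area
`2V/l_i`.

The upper bound on `T` (`IsTorsionFunction.integral_le`) is the dual principle: any field `σ` with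
divergence `-1` gives `T ≤ ∫ ‖σ‖^q`. The field `(R - x_0) e_0` along the short side yields exactly
`V R^q/(q+1)`.

The lower bound (`IsTorsionFunction.le_integral`) tests the equation with a multiple of the slab
profile `f(d) = (R^q - (R-d)^q)/q` of the distance `d` to the faces. By Young, `λ ∫ f(d) ≤ T/q + λ^p
∫ (R-d)^q / p`, and the last integral is `R^q V - q ∫ f(d)`, so a lower bound for `∫ f(d)` is
enough. The layer-cake formula supplies it, because `|{d > t}| = ∏ (l_i - 2t) ≥ V (1 - t/R)^M` by
Bernoulli's inequality. As `d` is only Lipschitz, it is approximated by a smooth log-sum-exp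
minimum, cut off near the boundary.

The torsion function is chosen by `Classical.epsilon`, so a weak solution must be shown to exist
(`exists_isTorsionFunction`, by the direct method). The bounds hold for every weak solution, so
uniqueness plays no role. -/

/-! ### Boxes: volume, topology, side lengths and inradius. -/

theorem volume_setOf_forall_lt_lt (a b : Fin D → ℝ) :
    volume {x : E D | ∀ i, a i < x i ∧ x i < b i} = ∏ i, ENNReal.ofReal (b i - a i) := by
  have h : {x : E D | ∀ i, a i < x i ∧ x i < b i}
      = WithLp.ofLp ⁻¹' (Set.univ.pi fun i => Set.Ioo (a i) (b i)) := by
    ext x; simp [Set.mem_pi]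
  rw [h, (PiLp.volume_preserving_ofLp (Fin D)).measure_preimage
    (MeasurableSet.univ_pi fun _ => measurableSet_Ioo).nullMeasurableSet, Real.volume_pi_Ioo]

theorem volume_setOf_forall_le_le (a b : Fin D → ℝ) :
    volume {x : E D | ∀ i, a i ≤ x i ∧ x i ≤ b i} = ∏ i, ENNReal.ofReal (b i - a i) := by
  have h : {x : E D | ∀ i, a i ≤ x i ∧ x i ≤ b i}
      = WithLp.ofLp ⁻¹' (Set.univ.pi fun i => Set.Icc (a i) (b i)) := by
    ext x; simp [Pi.le_def, forall_and]
  rw [h, (PiLp.volume_preserving_ofLp (Fin D)).measure_preimage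
    (MeasurableSet.univ_pi fun _ => measurableSet_Icc).nullMeasurableSet, Set.pi_univ_Icc,
    Real.volume_Icc_pi]

theorem continuous_coord (i : Fin D) : Continuous fun x : E D => x i :=
  (continuous_apply i).comp (PiLp.continuous_ofLp 2 _)

theorem isOpen_box (l : Fin D → ℝ) : IsOpen (box l) := by
  have h : box l = ⋂ i, {x : E D | 0 < x i ∧ x i < l i} := by ext; simp [box]
  rw [h]
  exact isOpen_iInter_of_finite fun i =>
    (isOpen_lt continuous_const (continuous_coord i)).inter
      (isOpen_lt (continuous_coord i) continuous_const)

theorem isClosed_setOf_forall_le_le (a b : Fin D → ℝ) :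
    IsClosed {x : E D | ∀ i, a i ≤ x i ∧ x i ≤ b i} := by
  have h : {x : E D | ∀ i, a i ≤ x i ∧ x i ≤ b i} = ⋂ i, {x : E D | a i ≤ x i ∧ x i ≤ b i} := by
    ext; simp
  rw [h]
  exact isClosed_iInter fun i =>
    (isClosed_le continuous_const (continuous_coord i)).inter
      (isClosed_le (continuous_coord i) continuous_const)

theorem isCompact_setOf_forall_le_le (a b : Fin D → ℝ) :
    IsCompact {x : E D | ∀ i, a i ≤ x i ∧ x i ≤ b i} := by
  have h : {x : E D | ∀ i, a i ≤ x i ∧ x i ≤ b i}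
      = (PiLp.homeomorph 2 fun _ : Fin D => ℝ) ⁻¹' (Set.Icc a b) := by
    ext x
    simp only [Set.mem_ofPred_eq, Set.mem_preimage, Set.mem_Icc, Pi.le_def, forall_and]
    rfl
  rw [h, Homeomorph.isCompact_preimage]
  exact isCompact_Icc

theorem volume_box (l : Fin D → ℝ) : volume (box l) = ∏ i, ENNReal.ofReal (l i) := by
  simpa [box] using volume_setOf_forall_lt_lt (fun _ => 0) l

theorem volume_box_ne_top (l : Fin D → ℝ) : volume (box l) ≠ ⊤ := by
  rw [volume_box]
  exact ENNReal.prod_ne_top fun _ _ => ENNReal.ofReal_ne_top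

theorem volumeReal_box {l : Fin D → ℝ} (hl : ∀ i, 0 < l i) : volume.real (box l) = ∏ i, l i := by
  rw [measureReal_def, volume_box, ENNReal.toReal_prod]
  exact Finset.prod_congr rfl fun i _ => ENNReal.toReal_ofReal (hl i).le

theorem volumeReal_box_pos {l : Fin D → ℝ} (hl : ∀ i, 0 < l i) : 0 < volume.real (box l) := by
  rw [volumeReal_box hl]
  exact Finset.prod_pos fun i _ => hl i

section Sides

variable {κ R : ℝ} {l : Fin D → ℝ}

theorem IsSides.two_mul_le (h : IsSides κ R l) (hκ : 2 ≤ κ) (i : Fin D) : 2 * R ≤ l i := by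
  by_cases hi : i.val = 0
  · exact (h.2.1 i hi).ge
  · exact (mul_le_mul_of_nonneg_right hκ h.1.le).trans (h.2.2 i hi)

theorem IsSides.pos (h : IsSides κ R l) (hκ : 2 ≤ κ) (i : Fin D) : 0 < l i :=
  lt_of_lt_of_le (by have := h.1; positivity) (h.two_mul_le hκ i)

/-- The sum controls both the perimeter ratio and `Q`; this is the only place where its size in
terms of `κ` enters. -/
theorem IsSides.sum_le (h : IsSides κ R l) (hκ : 2 ≤ κ) (hD : 2 ≤ D) :
    ∑ i, 2 * R / l i ≤ 1 + 2 * ((D : ℝ) - 1) / κ := by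
  obtain ⟨n, rfl⟩ : ∃ n, D = n + 1 := ⟨D - 1, by omega⟩
  have hR := h.1
  rw [Fin.sum_univ_succ, h.2.1 0 rfl, div_self (by positivity)]
  have : ∑ i : Fin n, 2 * R / l i.succ ≤ ∑ _i : Fin n, 2 / κ := by
    refine Finset.sum_le_sum fun i _ => ?_
    have h2 := h.2.2 i.succ (by simp)
    have hκ0 : 0 < κ := by linarith
    rw [div_le_div_iff₀ (h.pos hκ _) hκ0]
    nlinarith
  simp only [Finset.sum_const, Finset.card_univ, Fintype.card_fin, nsmul_eq_mul] at this
  push_cast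
  have h3 : 2 * ((n : ℝ) + 1 - 1) / κ = n * (2 / κ) := by ring
  linarith

theorem IsSides.inradius_box (h : IsSides κ R l) (hκ : 2 ≤ κ) (hD : 2 ≤ D) :
    inradius (box l) = R := by
  have hR := h.1
  obtain ⟨n, rfl⟩ : ∃ n, D = n + 1 := ⟨D - 1, by omega⟩
  refine IsGreatest.csSup_eq ⟨⟨hR, WithLp.toLp 2 fun i => l i / 2, ?_⟩, ?_⟩
  · intro y hy i
    rw [Metric.mem_ball, dist_eq_norm] at hy
    have h1 := (PiLp.norm_apply_le (y - WithLp.toLp 2 fun i => l i / 2) i).trans_lt hy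
    have h2 := h.two_mul_le hκ i
    simp only [PiLp.sub_apply, Real.norm_eq_abs] at h1
    rw [abs_lt] at h1
    constructor <;> linarith
  · rintro r ⟨hr, x, hx⟩
    by_contra! hlt
    -- A ball of radius `r > R` contains `x ± R e_0`, two points at distance `2R` in the direction
    -- of the open short side.
    have key : ∀ s : ℝ, |s| < r → 0 < x 0 + s ∧ x 0 + s < 2 * R := by
      intro s hs
      have := hx (show x + EuclideanSpace.single 0 s ∈ Metric.ball x r by simpa using hs) 0
      simpa [h.2.1 0 rfl] using this
    have h1 := (key (-R) (by rwa [abs_neg, abs_of_pos hR])).1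
    have h2 := (key R (by rwa [abs_of_pos hR])).2
    linarith

end Sides

/-! ### Perimeter of a box. -/

/-- The affine isometric embedding of `ℝ^n` in `ℝ^(n+1)` as the hyperplane `x i = c`. -/
def insertCoord {n : ℕ} (i : Fin (n + 1)) (c : ℝ) (y : E n) : E (n + 1) :=
  WithLp.toLp 2 (i.insertNth c y.ofLp : Fin (n + 1) → ℝ)

theorem isometry_insertCoord {n : ℕ} (i : Fin (n + 1)) (c : ℝ) : Isometry (insertCoord i c) := by
  refine Isometry.of_dist_eq fun x y => ?_
  rw [EuclideanSpace.dist_eq, EuclideanSpace.dist_eq, Fin.sum_univ_succAbove _ i]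
  simp [insertCoord]

theorem hausdorffMeasure_face {n : ℕ} (l : Fin (n + 1) → ℝ) (i : Fin (n + 1)) (c : ℝ) :
    Measure.euclideanHausdorffMeasure n
      {x : E (n + 1) | x i = c ∧ ∀ j, 0 ≤ x (i.succAbove j) ∧ x (i.succAbove j) ≤ l (i.succAbove j)}
      = ∏ j, ENNReal.ofReal (l (i.succAbove j)) := by
  have h : {x : E (n + 1) | x i = c ∧
        ∀ j, 0 ≤ x (i.succAbove j) ∧ x (i.succAbove j) ≤ l (i.succAbove j)}
      = insertCoord i c '' {y : E n | ∀ j, 0 ≤ y j ∧ y j ≤ l (i.succAbove j)} := by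
    ext x
    constructor
    · rintro ⟨hc, hx⟩
      refine ⟨WithLp.toLp 2 fun j => x (i.succAbove j), hx, ?_⟩
      ext k
      refine Fin.succAboveCases i ?_ (fun j => ?_) k <;> simp [insertCoord, hc]
    · rintro ⟨y, hy, rfl⟩
      simpa [insertCoord] using hy
  rw [h, (isometry_insertCoord i c).euclideanHausdorffMeasure_image,
    EuclideanSpace.euclideanHausdorffMeasure_eq_volume]
  simpa using volume_setOf_forall_le_le (fun _ => (0 : ℝ)) fun j => l (i.succAbove j)

theorem frontier_box_subset {n : ℕ} (l : Fin (n + 1) → ℝ) :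
    frontier (box l) ⊆ ⋃ i : Fin (n + 1),
      ({x : E (n + 1) | x i = 0 ∧
          ∀ j, 0 ≤ x (i.succAbove j) ∧ x (i.succAbove j) ≤ l (i.succAbove j)} ∪
        {x : E (n + 1) | x i = l i ∧
          ∀ j, 0 ≤ x (i.succAbove j) ∧ x (i.succAbove j) ≤ l (i.succAbove j)}) := by
  intro x hx
  rw [(isOpen_box l).frontier_eq] at hx
  have hc : ∀ i, 0 ≤ x i ∧ x i ≤ l i :=
    closure_minimal (fun y hy i => ⟨(hy i).1.le, (hy i).2.le⟩)
      (isClosed_setOf_forall_le_le (fun _ => 0) l) hx.1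
  have hn : ∃ i, 0 < x i → l i ≤ x i := by simpa [box] using hx.2
  obtain ⟨i, hi⟩ := hn
  refine Set.mem_iUnion.2 ⟨i, ?_⟩
  rcases (hc i).1.eq_or_lt with h0 | h0
  · exact Or.inl ⟨h0.symm, fun j => hc _⟩
  · exact Or.inr ⟨le_antisymm (hc i).2 (hi h0), fun j => hc _⟩

/-- Covering the frontier by the `2D` closed faces and using subadditivity suffices, so the overlaps
of the faces need not be examined. -/
theorem perimeter_box_le (hD : 1 ≤ D) {l : Fin D → ℝ} (hl : ∀ i, 0 < l i) :
    perimeter (box l) ≤ ENNReal.ofReal (∑ i, 2 * ((∏ j, l j) / l i)) := by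
  obtain ⟨n, rfl⟩ : ∃ n, D = n + 1 := ⟨D - 1, by omega⟩
  refine (measure_mono (frontier_box_subset l)).trans ((measure_iUnion_fintype_le _ _).trans ?_)
  have hnn : ∀ i ∈ Finset.univ, 0 ≤ 2 * ((∏ j, l j) / l i) := fun i _ =>
    mul_nonneg zero_le_two (div_nonneg (Finset.prod_nonneg fun j _ => (hl j).le) (hl i).le)
  rw [ENNReal.ofReal_sum_of_nonneg hnn]
  refine Finset.sum_le_sum fun i _ => (measure_union_le _ _).trans ?_
  simp only [Nat.add_sub_cancel]
  rw [hausdorffMeasure_face, hausdorffMeasure_face, ← two_mul, ENNReal.ofReal_mul zero_le_two,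
    Fin.prod_univ_succAbove _ i, mul_div_cancel_left₀ _ (hl i).ne',
    ENNReal.ofReal_prod_of_nonneg fun j _ => (hl _).le]
  simp

theorem IsSides.perimeter_ratio_le {κ R : ℝ} {l : Fin D → ℝ} (h : IsSides κ R l) (hκ : 2 ≤ κ)
    (hD : 2 ≤ D) : R * (perimeter (box l)).toReal / volume.real (box l)
      ≤ 1 + 2 * ((D : ℝ) - 1) / κ := by
  have hl := h.pos hκ
  have hR := h.1
  have hP : (perimeter (box l)).toReal ≤ ∑ i, 2 * ((∏ j, l j) / l i) := by
    refine ENNReal.toReal_le_of_le_ofReal ?_ (perimeter_box_le (by omega) hl)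
    exact Finset.sum_nonneg fun i _ => mul_nonneg zero_le_two
      (div_nonneg (Finset.prod_nonneg fun j _ => (hl j).le) (hl i).le)
  have hV := volumeReal_box_pos hl
  refine le_trans ?_ (h.sum_le hκ hD)
  rw [div_le_iff₀ hV]
  refine (mul_le_mul_of_nonneg_left hP hR.le).trans (le_of_eq ?_)
  rw [volumeReal_box hl, Finset.mul_sum, Finset.sum_mul]
  refine Finset.sum_congr rfl fun i _ => ?_
  ring


/-! ### Quantitative strict convexity of the `p`-th power of a Hilbert norm. -/

section ConvexityDefect

variable {F : Type*} [NormedAddCommGroup F] [InnerProductSpace ℝ F] {p : ℝ}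

/-- The defect in the midpoint convexity inequality for `‖·‖ ^ p`. -/
def convexityDefect (p : ℝ) (a b : F) : ℝ :=
  (‖a‖ ^ p + ‖b‖ ^ p) / 2 - ‖(2⁻¹ : ℝ) • (a + b)‖ ^ p

/-- If the norms agree, strictness comes from the triangle inequality in a strictly convex space; if
they differ, from strict convexity of `t ^ p`. -/
theorem convexityDefect_pos (hp : 1 < p) {a b : F} (h : a ≠ b) : 0 < convexityDefect p a b := by
  have hp0 : 0 < p := by linarith
  have hm : ‖(2⁻¹ : ℝ) • (a + b)‖ = ‖a + b‖ / 2 := by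
    rw [norm_smul]; norm_num; ring
  rw [convexityDefect, hm, sub_pos]
  by_cases hab : ‖a‖ = ‖b‖
  · have : ‖a + b‖ / 2 < ‖b‖ := by
      have h1 : ‖a + b‖ ≠ ‖a‖ + ‖b‖ := fun h2 =>
        h (((sameRay_iff_norm_add).2 h2).eq_of_norm_eq hab)
      have h2 := lt_of_le_of_ne (norm_add_le a b) h1
      linarith
    have := Real.rpow_lt_rpow (by positivity) this hp0
    rw [hab]; linarith
  · have h1 := (strictConvexOn_rpow hp).2 (norm_nonneg a) (norm_nonneg b) hab
      (show (0 : ℝ) < 1 / 2 by norm_num) (show (0 : ℝ) < 1 / 2 by norm_num) (by norm_num)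
    simp only [smul_eq_mul] at h1
    have h2 : (‖a + b‖ / 2) ^ p ≤ (1 / 2 * ‖a‖ + 1 / 2 * ‖b‖) ^ p :=
      Real.rpow_le_rpow (by positivity) (by linarith [norm_add_le a b]) hp0.le
    linarith

theorem convexityDefect_nonneg (hp : 1 < p) (a b : F) : 0 ≤ convexityDefect p a b := by
  by_cases h : a = b
  · subst h
    rw [convexityDefect, ← two_smul ℝ a, smul_smul]
    norm_num
  · exact (convexityDefect_pos hp h).le

theorem convexityDefect_smul {r : ℝ} (hr : 0 ≤ r) (a b : F) :
    convexityDefect p (r • a) (r • b) = r ^ p * convexityDefect p a b := by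
  have h : (2⁻¹ : ℝ) • (r • a + r • b) = r • ((2⁻¹ : ℝ) • (a + b)) := by
    rw [← smul_add, smul_comm]
  simp only [convexityDefect]
  rw [h, norm_smul, norm_smul, norm_smul, Real.norm_of_nonneg hr,
    Real.mul_rpow hr (norm_nonneg _), Real.mul_rpow hr (norm_nonneg _),
    Real.mul_rpow hr (norm_nonneg _)]
  ring

/-- A substitute for Clarkson's inequalities that treats all `p > 1` at once: both sides are
`p`-homogeneous, so compactness of the unit sphere of `F × F` gives the constant. -/
theorem exists_norm_sub_rpow_le [FiniteDimensional ℝ F] (hp : 1 < p) {ε : ℝ} (hε : 0 < ε) :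
    ∃ C : ℝ, 0 < C ∧ ∀ a b : F,
      ‖a - b‖ ^ p ≤ ε * (‖a‖ ^ p + ‖b‖ ^ p) + C * convexityDefect p a b := by
  have hp0 : 0 < p := by linarith
  have : ProperSpace F := FiniteDimensional.proper_real F
  -- `K` is compact and misses the diagonal, so the defect has a positive lower bound `δ` on it. Off
  -- `K` the term with `ε` already suffices; on `K` the bound `‖a - b‖ ≤ 2r` produces `C = 2 ^ p /
  -- δ`.
  let K : Set (F × F) := Metric.sphere 0 1 ∩ {z | ε ≤ ‖z.1 - z.2‖ ^ p}
  have hK : IsCompact K := (isCompact_sphere _ _).inter_right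
    (isClosed_le continuous_const
      ((continuous_fst.sub continuous_snd).norm.rpow_const fun _ => Or.inr hp0.le))
  have hc : Continuous fun z : F × F => convexityDefect p z.1 z.2 := by
    unfold convexityDefect
    have h1 : Continuous fun z : F × F => ‖z.1‖ ^ p :=
      continuous_fst.norm.rpow_const fun _ => Or.inr hp0.le
    have h2 : Continuous fun z : F × F => ‖z.2‖ ^ p :=
      continuous_snd.norm.rpow_const fun _ => Or.inr hp0.le
    have h3 : Continuous fun z : F × F => ‖(2⁻¹ : ℝ) • (z.1 + z.2)‖ ^ p :=
      ((continuous_fst.add continuous_snd).const_smul _).norm.rpow_const fun _ => Or.inr hp0.le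
    exact ((h1.add h2).div_const 2).sub h3
  obtain ⟨δ, hδ, hKδ⟩ := hK.exists_forall_le' hc.continuousOn (a := 0) (by
    rintro ⟨a, b⟩ ⟨-, h⟩
    refine convexityDefect_pos hp fun hab => ?_
    simp only at hab
    subst hab
    simp only [Set.mem_ofPred_eq, sub_self, norm_zero, Real.zero_rpow hp0.ne'] at h
    linarith)
  refine ⟨2 ^ p / δ, by positivity, fun a b => ?_⟩
  by_cases hz : (a, b) = (0 : F × F)
  · obtain ⟨rfl, rfl⟩ := Prod.mk_eq_zero.1 hz
    simp [convexityDefect, Real.zero_rpow hp0.ne']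
  set r := ‖(a, b)‖ with hr
  have hr0 : 0 < r := norm_pos_iff.2 hz
  have ha : a = r • (r⁻¹ • a) := by rw [smul_smul, mul_inv_cancel₀ hr0.ne', one_smul]
  have hb : b = r • (r⁻¹ • b) := by rw [smul_smul, mul_inv_cancel₀ hr0.ne', one_smul]
  have hrle : r ^ p ≤ ‖a‖ ^ p + ‖b‖ ^ p := by
    rcases max_choice ‖a‖ ‖b‖ with h | h <;> rw [hr, Prod.norm_def, h]
    · have : 0 ≤ ‖b‖ ^ p := by positivity
      linarith
    · have : 0 ≤ ‖a‖ ^ p := by positivity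
      linarith
  have hd := convexityDefect_nonneg hp a b
  have hsub : ‖a - b‖ ^ p = r ^ p * ‖r⁻¹ • a - r⁻¹ • b‖ ^ p := by
    rw [← Real.mul_rpow hr0.le (norm_nonneg _)]
    congr 1
    rw [← smul_sub, norm_smul, Real.norm_of_nonneg (by positivity), mul_inv_cancel_left₀ hr0.ne']
  by_cases hε' : ε ≤ ‖r⁻¹ • a - r⁻¹ • b‖ ^ p
  · have hmem : ((r⁻¹ • a, r⁻¹ • b) : F × F) ∈ K := by
      refine ⟨?_, hε'⟩
      rw [mem_sphere_zero_iff_norm, ← Prod.smul_mk, norm_smul, ← hr,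
        Real.norm_of_nonneg (by positivity), inv_mul_cancel₀ hr0.ne']
    have h1 := hKδ _ hmem
    simp only at h1
    have h2 : convexityDefect p a b = r ^ p * convexityDefect p (r⁻¹ • a) (r⁻¹ • b) := by
      rw [← convexityDefect_smul hr0.le, ← ha, ← hb]
    have h3 : ‖a - b‖ ^ p ≤ (2 * r) ^ p := by
      refine Real.rpow_le_rpow (norm_nonneg _) ((norm_sub_le a b).trans ?_) hp0.le
      have h4 : ‖a‖ ≤ r := norm_fst_le (a, b)
      have h5 : ‖b‖ ≤ r := norm_snd_le (a, b)
      linarith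
    rw [Real.mul_rpow zero_le_two hr0.le] at h3
    have h4 : 2 ^ p * r ^ p ≤ 2 ^ p / δ * convexityDefect p a b := by
      rw [h2, div_mul_eq_mul_div, le_div_iff₀ hδ]
      have : r ^ p * δ ≤ r ^ p * convexityDefect p (r⁻¹ • a) (r⁻¹ • b) :=
        mul_le_mul_of_nonneg_left h1 (by positivity)
      calc 2 ^ p * r ^ p * δ = 2 ^ p * (r ^ p * δ) := by ring
        _ ≤ _ := mul_le_mul_of_nonneg_left this (by positivity)
    have h5 : 0 ≤ ε * (‖a‖ ^ p + ‖b‖ ^ p) := by positivity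
    linarith
  · rw [hsub]
    have h1 : r ^ p * ‖r⁻¹ • a - r⁻¹ • b‖ ^ p ≤ (‖a‖ ^ p + ‖b‖ ^ p) * ε :=
      mul_le_mul hrle (not_le.1 hε').le (by positivity) (by positivity)
    have h2 : 0 ≤ 2 ^ p / δ * convexityDefect p a b := by positivity
    linarith

end ConvexityDefect

/-! ### Convergence, completeness and Hölder duality in `L^p`. -/

section Lp

variable {α F : Type*} [MeasurableSpace α] {μ : Measure α} [NormedAddCommGroup F] {p : ℝ}

theorem integrable_norm_rpow_of_memLp (hp : 1 < p) {f : α → F}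
    (hf : MemLp f (ENNReal.ofReal p) μ) : Integrable (fun x => ‖f x‖ ^ p) μ := by
  have h := hf.integrable_norm_rpow (by simp; linarith) ENNReal.ofReal_ne_top
  rwa [ENNReal.toReal_ofReal (by linarith)] at h

theorem eLpNorm_toReal_rpow (hp : 1 < p) {f : α → F} (hf : MemLp f (ENNReal.ofReal p) μ) :
    (eLpNorm f (ENNReal.ofReal p) μ).toReal ^ p = ∫ x, ‖f x‖ ^ p ∂μ := by
  have hp0 : 0 < p := by linarith
  rw [hf.eLpNorm_eq_integral_rpow_norm (by simpa using hp0) ENNReal.ofReal_ne_top,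
    ENNReal.toReal_ofReal hp0.le, ENNReal.toReal_ofReal (by positivity),
    Real.rpow_inv_rpow (by positivity) hp0.ne']

theorem tendsto_integral_norm_rpow (hp : 1 < p) {f : ℕ → α → F} {g : α → F}
    (hf : ∀ n, MemLp (f n) (ENNReal.ofReal p) μ) (hg : MemLp g (ENNReal.ofReal p) μ)
    (h : Tendsto (fun n => eLpNorm (fun x => f n x - g x) (ENNReal.ofReal p) μ) atTop (𝓝 0)) :
    Tendsto (fun n => ∫ x, ‖f n x‖ ^ p ∂μ) atTop (𝓝 (∫ x, ‖g x‖ ^ p ∂μ)) := by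
  have : Fact (1 ≤ ENNReal.ofReal p) := ⟨by simpa using hp.le⟩
  have h1 := ((Lp.tendsto_Lp_iff_tendsto_eLpNorm'' f hf g hg).2 h).norm.rpow_const
    (p := p) (Or.inr (by linarith))
  simpa only [Lp.norm_toLp, eLpNorm_toReal_rpow hp (hf _), eLpNorm_toReal_rpow hp hg] using h1

theorem exists_memLp_tendsto [CompleteSpace F] (hp : 1 < p) {f : ℕ → α → F}
    (hf : ∀ n, MemLp (f n) (ENNReal.ofReal p) μ)
    (h : ∀ ε > 0, ∃ N, ∀ m ≥ N, ∀ n ≥ N, ∫ x, ‖f m x - f n x‖ ^ p ∂μ < ε) :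
    ∃ g : α → F, MemLp g (ENNReal.ofReal p) μ ∧
      Tendsto (fun n => eLpNorm (fun x => f n x - g x) (ENNReal.ofReal p) μ) atTop (𝓝 0) := by
  have : Fact (1 ≤ ENNReal.ofReal p) := ⟨by simpa using hp.le⟩
  have hp0 : 0 < p := by linarith
  have hc : CauchySeq fun n => (hf n).toLp (f n) := by
    rw [Metric.cauchySeq_iff]
    intro ε hε
    obtain ⟨N, hN⟩ := h (ε ^ p) (by positivity)
    refine ⟨N, fun m hm n hn => ?_⟩
    rw [dist_eq_norm, ← MemLp.toLp_sub, Lp.norm_toLp]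
    refine (Real.rpow_lt_rpow_iff ENNReal.toReal_nonneg hε.le hp0).1 ?_
    rw [eLpNorm_toReal_rpow hp ((hf m).sub (hf n))]
    exact hN m hm n hn
  obtain ⟨G, hG⟩ := cauchySeq_tendsto_of_complete hc
  refine ⟨G, Lp.memLp G, ?_⟩
  have := (Lp.tendsto_Lp_iff_tendsto_eLpNorm'' f hf G (Lp.memLp G)).1 (by rwa [Lp.toLp_coeFn])
  exact this

theorem integrable_inner_of_memLp {F : Type*} [NormedAddCommGroup F] [InnerProductSpace ℝ F] {q : ℝ}
    (hpq : p.HolderConjugate q) {k g : α → F} (hk : MemLp k (ENNReal.ofReal q) μ)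
    (hg : MemLp g (ENNReal.ofReal p) μ) : Integrable (fun x => inner ℝ (k x) (g x)) μ := by
  have hH : ENNReal.HolderTriple (ENNReal.ofReal q) (ENNReal.ofReal p) 1 := hpq.symm.ennrealOfReal
  refine Integrable.mono' (g := fun x => ‖k x‖ * ‖g x‖)
    (memLp_one_iff_integrable.1 (hg.norm.mul hk.norm)) (hk.1.inner hg.1)
    (ae_of_all _ fun x => norm_inner_le_norm _ _)

theorem tendsto_integral_inner {F : Type*} [NormedAddCommGroup F] [InnerProductSpace ℝ F] {q : ℝ}
    (hpq : p.HolderConjugate q) {k : α → F} (hk : MemLp k (ENNReal.ofReal q) μ)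
    {f : ℕ → α → F} {g : α → F}
    (hf : ∀ n, MemLp (f n) (ENNReal.ofReal p) μ) (hg : MemLp g (ENNReal.ofReal p) μ)
    (h : Tendsto (fun n => eLpNorm (fun x => f n x - g x) (ENNReal.ofReal p) μ) atTop (𝓝 0)) :
    Tendsto (fun n => ∫ x, inner ℝ (k x) (f n x) ∂μ) atTop (𝓝 (∫ x, inner ℝ (k x) (g x) ∂μ)) := by
  have hH : ENNReal.HolderTriple (ENNReal.ofReal q) (ENNReal.ofReal p) 1 := hpq.symm.ennrealOfReal
  have hI : ∀ {w : α → F}, MemLp w (ENNReal.ofReal p) μ →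
      eLpNorm (fun x => inner ℝ (k x) (w x)) 1 μ
        ≤ eLpNorm k (ENNReal.ofReal q) μ * eLpNorm w (ENNReal.ofReal p) μ := fun {w} hw => by
    simpa using eLpNorm_le_eLpNorm_mul_eLpNorm_of_nnnorm hk.1 hw.1 (fun a b => inner ℝ a b) 1
      (ae_of_all _ fun x => by simpa using nnnorm_inner_le_nnnorm (𝕜 := ℝ) (k x) (w x))
  refine tendsto_integral_of_L1' _ (integrable_inner_of_memLp hpq hk hg).1
    (Eventually.of_forall fun n => integrable_inner_of_memLp hpq hk (hf n)) ?_
  have h0 : Tendsto (fun n => eLpNorm k (ENNReal.ofReal q) μ *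
      eLpNorm (fun x => f n x - g x) (ENNReal.ofReal p) μ) atTop (𝓝 0) := by
    simpa using ENNReal.Tendsto.const_mul h (Or.inr hk.2.ne)
  refine tendsto_of_tendsto_of_tendsto_of_le_of_le tendsto_const_nhds h0 (fun _ => zero_le)
    fun n => ?_
  have := hI ((hf n).sub hg)
  simp only [Pi.sub_apply, inner_sub_right] at this
  exact this

/-- The exponents match because `(p - 1) q = p`; hence the flux of an `L^p` gradient lies in `L^q`.
-/
theorem norm_norm_rpow_smul_rpow {F : Type*} [NormedAddCommGroup F] [NormedSpace ℝ F]
    {q : ℝ} (hpq : p.HolderConjugate q) (a : F) : ‖‖a‖ ^ (p - 2) • a‖ ^ q = ‖a‖ ^ p := by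
  have hp := hpq.lt
  have hq := hpq.symm.lt
  rw [norm_smul, Real.norm_of_nonneg (by positivity)]
  rcases (norm_nonneg a).eq_or_lt with h0 | h0
  · rw [← h0, mul_zero, Real.zero_rpow (by linarith), Real.zero_rpow (by linarith)]
  · rw [← Real.rpow_add_one h0.ne', ← Real.rpow_mul h0.le]
    congr 1
    have := hpq.sub_one_mul_conj
    linarith

theorem memLp_norm_rpow_smul {F : Type*} [NormedAddCommGroup F] [NormedSpace ℝ F] {q : ℝ}
    (hpq : p.HolderConjugate q) {g : α → F} (hg : MemLp g (ENNReal.ofReal p) μ) :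
    MemLp (fun x => ‖g x‖ ^ (p - 2) • g x) (ENNReal.ofReal q) μ := by
  have hp := hpq.lt
  have hq := hpq.symm.lt
  have hm : AEStronglyMeasurable (fun x => ‖g x‖ ^ (p - 2) • g x) μ :=
    (hg.1.norm.aemeasurable.pow_const (p - 2)).aestronglyMeasurable.smul hg.1
  rw [← integrable_norm_rpow_iff hm (by simp; linarith) ENNReal.ofReal_ne_top,
    ENNReal.toReal_ofReal (by linarith)]
  refine (integrable_norm_rpow_of_memLp hp hg).congr (ae_of_all _ fun x => ?_)
  exact (norm_norm_rpow_smul_rpow hpq (g x)).symm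

end Lp


/-! ### Test functions and integration by parts against a coordinate field. -/

section TestFunctions

variable {Ω : Set (E D)} {φ ψ : E D → ℝ}

theorem norm_gradient (φ : E D → ℝ) (x : E D) : ‖gradient φ x‖ = ‖fderiv ℝ φ x‖ := by
  simp [gradient]

theorem IsTestFunction.contDiff_one (h : IsTestFunction Ω φ) : ContDiff ℝ 1 φ :=
  h.1.of_le (by exact_mod_cast le_top)

theorem IsTestFunction.differentiable (h : IsTestFunction Ω φ) : Differentiable ℝ φ :=
  h.contDiff_one.differentiable one_ne_zero

theorem IsTestFunction.memLp (h : IsTestFunction Ω φ) (P : ℝ≥0∞) (s : Set (E D)) :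
    MemLp φ P (volume.restrict s) :=
  (h.contDiff_one.continuous.memLp_of_hasCompactSupport h.2.1).restrict s

theorem IsTestFunction.continuous_gradient (h : IsTestFunction Ω φ) : Continuous (gradient φ) :=
  (InnerProductSpace.toDual ℝ (E D)).symm.continuous.comp
    (h.contDiff_one.continuous_fderiv one_ne_zero)

theorem IsTestFunction.hasCompactSupport_gradient (h : IsTestFunction Ω φ) :
    HasCompactSupport (gradient φ) :=
  (h.2.1.fderiv ℝ).comp_left (map_zero (InnerProductSpace.toDual ℝ (E D)).symm)

theorem IsTestFunction.memLp_gradient (h : IsTestFunction Ω φ) (P : ℝ≥0∞) (s : Set (E D)) :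
    MemLp (gradient φ) P (volume.restrict s) :=
  (h.continuous_gradient.memLp_of_hasCompactSupport h.hasCompactSupport_gradient).restrict s

theorem IsTestFunction.eq_zero (h : IsTestFunction Ω φ) {x : E D} (hx : x ∉ Ω) : φ x = 0 :=
  image_eq_zero_of_notMem_tsupport fun hx' => hx (h.2.2 hx')

theorem IsTestFunction.gradient_eq_zero (h : IsTestFunction Ω φ) {x : E D} (hx : x ∉ Ω) :
    gradient φ x = 0 := by
  rw [← norm_eq_zero, norm_gradient, norm_eq_zero]
  exact image_eq_zero_of_notMem_tsupport fun hx' => hx (h.2.2 (tsupport_fderiv_subset ℝ hx'))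

theorem isTestFunction_zero : IsTestFunction Ω 0 :=
  ⟨contDiff_const, HasCompactSupport.zero, by simp [tsupport]⟩

theorem IsTestFunction.add (h : IsTestFunction Ω φ) (h' : IsTestFunction Ω ψ) :
    IsTestFunction Ω (φ + ψ) :=
  ⟨h.1.add h'.1, h.2.1.add h'.2.1,
    (tsupport_add φ ψ).trans (Set.union_subset h.2.2 h'.2.2)⟩

theorem IsTestFunction.smul (h : IsTestFunction Ω φ) (c : ℝ) : IsTestFunction Ω (c • φ) :=
  ⟨contDiff_const.smul h.1, h.2.1.smul_left,
    (closure_mono (Function.support_const_smul_subset c φ)).trans h.2.2⟩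

theorem IsTestFunction.gradient_add (h : IsTestFunction Ω φ) (h' : IsTestFunction Ω ψ) (x : E D) :
    gradient (φ + ψ) x = gradient φ x + gradient ψ x := by
  simp only [gradient]
  rw [fderiv_add (h.differentiable x) (h'.differentiable x), map_add]

theorem IsTestFunction.gradient_smul (h : IsTestFunction Ω φ) (c : ℝ) (x : E D) :
    gradient (c • φ) x = c • gradient φ x := by
  simp only [gradient]
  rw [fderiv_const_smul (h.differentiable x) c, map_smul]

theorem IsTestFunction.sub (h : IsTestFunction Ω φ) (h' : IsTestFunction Ω ψ) :
    IsTestFunction Ω (φ - ψ) := by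
  simpa [sub_eq_add_neg] using h.add (h'.smul (-1))

theorem IsTestFunction.gradient_sub (h : IsTestFunction Ω φ) (h' : IsTestFunction Ω ψ) (x : E D) :
    gradient (φ - ψ) x = gradient φ x - gradient ψ x := by
  simp only [gradient]
  rw [fderiv_sub (h.differentiable x) (h'.differentiable x), map_sub]

end TestFunctions

/-- Only `C^1` is required, so that the identity also applies to `‖φ‖ ^ p`, which need not be
smooth. -/
theorem integral_eq_integral_mul_fderiv (i : Fin D) (c : ℝ) {h : E D → ℝ} (hh : ContDiff ℝ 1 h)
    (hc : HasCompactSupport h) :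
    ∫ x, h x = ∫ x, (c - x i) * fderiv ℝ h x (EuclideanSpace.single i 1) := by
  let L : E D →L[ℝ] ℝ := EuclideanSpace.proj i
  have hf : ∀ x : E D, HasFDerivAt (fun x : E D => c - x i) (-L) x := fun x => by
    exact (L.hasFDerivAt (x := x)).const_sub c
  have hcf : Continuous fun x : E D => c - x i := continuous_const.sub (continuous_coord i)
  have hd : Continuous fun x => fderiv ℝ h x (EuclideanSpace.single i 1) :=
    (hh.continuous_fderiv one_ne_zero).clm_apply continuous_const
  have hdc : HasCompactSupport fun x => fderiv ℝ h x (EuclideanSpace.single i 1) :=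
    hc.fderiv_apply ℝ _
  have hv : ∀ x, fderiv ℝ (fun x : E D => c - x i) x (EuclideanSpace.single i 1) = -1 := fun x => by
    rw [(hf x).fderiv]; simp [L]
  rw [integral_mul_fderiv_eq_neg_fderiv_mul_of_integrable]
  · simp only [hv]
    simp [integral_neg]
  · simp only [hv]
    exact (continuous_const.mul hh.continuous).integrable_of_hasCompactSupport hc.mul_left
  · exact (hcf.mul hd).integrable_of_hasCompactSupport hdc.mul_left
  · exact (hcf.mul hh.continuous).integrable_of_hasCompactSupport hc.mul_left
  · exact fun x _ => (hf x).differentiableAt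
  · exact fun x _ => hh.differentiable one_ne_zero x

/-- The field `(c - x_i) e_i`, whose divergence is `-1`. -/
def coordField (i : Fin D) (c : ℝ) (x : E D) : E D :=
  (c - x i) • EuclideanSpace.single i 1

theorem norm_coordField (i : Fin D) (c : ℝ) (x : E D) : ‖coordField i c x‖ = |c - x i| := by
  simp [coordField, norm_smul]

theorem continuous_coordField (i : Fin D) (c : ℝ) : Continuous (coordField i c) :=
  (continuous_const.sub (continuous_coord i)).smul continuous_const

theorem IsTestFunction.integral_eq {Ω : Set (E D)} {φ : E D → ℝ} (h : IsTestFunction Ω φ)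
    (i : Fin D) (c : ℝ) :
    ∫ x in Ω, φ x = ∫ x in Ω, inner ℝ (coordField i c x) (gradient φ x) := by
  rw [setIntegral_eq_integral_of_forall_compl_eq_zero fun x hx => h.eq_zero hx,
    setIntegral_eq_integral_of_forall_compl_eq_zero fun x hx => by
      rw [h.gradient_eq_zero hx, inner_zero_right],
    integral_eq_integral_mul_fderiv i c h.contDiff_one h.2.1]
  simp [coordField]

section Young

variable {α F : Type*} [MeasurableSpace α] {μ : Measure α} [NormedAddCommGroup F]
  [InnerProductSpace ℝ F] {p q : ℝ}

theorem inner_le_young (hpq : p.HolderConjugate q) (a b : F) :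
    inner ℝ a b ≤ ‖a‖ ^ q / q + ‖b‖ ^ p / p :=
  (real_inner_le_norm a b).trans
    (Real.young_inequality_of_nonneg (norm_nonneg a) (norm_nonneg b) hpq.symm)

theorem integral_inner_le_young (hpq : p.HolderConjugate q) {k g : α → F}
    (hk : MemLp k (ENNReal.ofReal q) μ) (hg : MemLp g (ENNReal.ofReal p) μ) :
    ∫ x, inner ℝ (k x) (g x) ∂μ ≤ (∫ x, ‖k x‖ ^ q ∂μ) / q + (∫ x, ‖g x‖ ^ p ∂μ) / p := by
  have h1 := (integrable_norm_rpow_of_memLp hpq.symm.lt hk).div_const q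
  have h2 := (integrable_norm_rpow_of_memLp hpq.lt hg).div_const p
  rw [← integral_div, ← integral_div, ← integral_add h1 h2]
  exact integral_mono (integrable_inner_of_memLp hpq hk hg) (h1.add h2)
    fun x => inner_le_young hpq _ _

end Young

/-! ### Poincaré's inequality on a box. -/

section Box

variable {l : Fin D → ℝ} {p q : ℝ}

theorem isFiniteMeasure_restrict_box (l : Fin D → ℝ) :
    IsFiniteMeasure (volume.restrict (box l)) :=
  ⟨by simpa using (volume_box_ne_top l).lt_top⟩

theorem measurableSet_box (l : Fin D → ℝ) : MeasurableSet (box l) := (isOpen_box l).measurableSet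

theorem norm_coordField_le {x : E D} (hx : x ∈ box l) (i : Fin D) :
    ‖coordField i (l i / 2) x‖ ≤ l i / 2 := by
  rw [norm_coordField, abs_le]
  constructor <;> linarith [(hx i).1, (hx i).2]

theorem memLp_coordField (l : Fin D → ℝ) (i : Fin D) (P : ℝ≥0∞) :
    MemLp (coordField i (l i / 2)) P (volume.restrict (box l)) := by
  have := isFiniteMeasure_restrict_box l
  exact MemLp.of_bound (continuous_coordField i _).aestronglyMeasurable (l i / 2)
    ((ae_restrict_iff' (measurableSet_box l)).2 (ae_of_all _ fun x hx => norm_coordField_le hx i))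

/-- Integrate `‖φ‖ ^ p` by parts against `l_i/2 - x_i`, which is at most `l_i/2` in size on the box,
and split `‖φ‖ ^ (p-1) · r ‖∇φ‖` by Young. -/
theorem IsTestFunction.integral_norm_rpow_le (hpq : p.HolderConjugate q) {φ : E D → ℝ}
    (h : IsTestFunction (box l) φ) (i : Fin D) :
    ∫ x in box l, ‖φ x‖ ^ p ≤ (p * (l i / 2)) ^ p * ∫ x in box l, ‖gradient φ x‖ ^ p := by
  have hp := hpq.lt
  have hp0 : 0 < p := by linarith
  by_cases hl : l i ≤ 0
  · have : box l = ∅ := by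
      ext x
      simp only [Set.mem_empty_iff_false, iff_false]
      exact fun hx => by linarith [(hx i).1, (hx i).2]
    simp [this]
  push Not at hl
  set r := p * (l i / 2) with hr
  have hr0 : 0 < r := by positivity
  have hcd : ContDiff ℝ 1 fun x => ‖φ x‖ ^ p := h.contDiff_one.norm_rpow hp
  have hcs : HasCompactSupport fun x => ‖φ x‖ ^ p :=
    h.2.1.comp_left (g := fun y : ℝ => ‖y‖ ^ p) (by simp [Real.zero_rpow hp0.ne'])
  have hz : ∀ x, x ∉ box l → fderiv ℝ (fun x => ‖φ x‖ ^ p) x = 0 := fun x hx => by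
    have := norm_fderiv_norm_rpow_le h.differentiable (x := x) hp
    rw [h.eq_zero hx, norm_zero, Real.zero_rpow (by linarith), mul_zero, zero_mul] at this
    exact norm_le_zero_iff.1 this
  have hi1 := integrable_norm_rpow_of_memLp hp (h.memLp (ENNReal.ofReal p) (box l))
  have hi2 := integrable_norm_rpow_of_memLp hp (h.memLp_gradient (ENNReal.ofReal p) (box l))
  have hle : ∫ x in box l, ‖φ x‖ ^ p
      ≤ ∫ x in box l, (‖φ x‖ ^ p / q + r ^ p * ‖gradient φ x‖ ^ p / p) := by
    have he : ∫ x in box l, ‖φ x‖ ^ p = ∫ x in box l, (l i / 2 - x i) *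
        fderiv ℝ (fun x => ‖φ x‖ ^ p) x (EuclideanSpace.single i 1) := by
      rw [setIntegral_eq_integral_of_forall_compl_eq_zero fun x hx => by
          rw [h.eq_zero hx, norm_zero, Real.zero_rpow hp0.ne'],
        setIntegral_eq_integral_of_forall_compl_eq_zero fun x hx => by
          rw [hz x hx]; simp,
        integral_eq_integral_mul_fderiv i (l i / 2) hcd hcs]
    rw [he]
    refine setIntegral_mono_on ?_ ((hi1.div_const q).add ((hi2.const_mul _).div_const p))
      (measurableSet_box l) fun x hx => ?_
    · have hcont : Continuous fun x : E D => (l i / 2 - x i) *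
          fderiv ℝ (fun x => ‖φ x‖ ^ p) x (EuclideanSpace.single i 1) :=
        (continuous_const.sub (continuous_coord i)).mul
          ((hcd.continuous_fderiv one_ne_zero).clm_apply continuous_const)
      exact (hcont.integrable_of_hasCompactSupport (hcs.fderiv_apply ℝ _).mul_left).integrableOn
    · have h1 : |l i / 2 - x i| ≤ l i / 2 := by
        rw [← norm_coordField]; exact norm_coordField_le hx i
      have h2 : |fderiv ℝ (fun x => ‖φ x‖ ^ p) x (EuclideanSpace.single i 1)|
          ≤ p * ‖φ x‖ ^ (p - 1) * ‖gradient φ x‖ := by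
        rw [norm_gradient]
        refine le_trans ?_ (norm_fderiv_norm_rpow_le h.differentiable hp)
        simpa using (fderiv ℝ (fun x => ‖φ x‖ ^ p) x).le_opNorm (EuclideanSpace.single i 1)
      have h3 : ‖φ x‖ ^ (p - 1) * (r * ‖gradient φ x‖)
          ≤ (‖φ x‖ ^ (p - 1)) ^ q / q + (r * ‖gradient φ x‖) ^ p / p :=
        Real.young_inequality_of_nonneg (by positivity) (by positivity) hpq.symm
      rw [← Real.rpow_mul (norm_nonneg _), hpq.sub_one_mul_conj,
        Real.mul_rpow hr0.le (norm_nonneg _)] at h3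
      refine le_trans ?_ h3
      calc _ ≤ |l i / 2 - x i| * |fderiv ℝ (fun x => ‖φ x‖ ^ p) x (EuclideanSpace.single i 1)| := by
            rw [← abs_mul]; exact le_abs_self _
        _ ≤ (l i / 2) * (p * ‖φ x‖ ^ (p - 1) * ‖gradient φ x‖) :=
            mul_le_mul h1 h2 (abs_nonneg _) (by positivity)
        _ = _ := by rw [hr]; ring
  rw [integral_add (hi1.div_const q) ((hi2.const_mul _).div_const p), integral_div, integral_div,
    integral_const_mul] at hle
  -- Absorbing `1/q` of the left-hand integral leaves the factor `1/p` on both sides.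
  have hq : q⁻¹ = 1 - p⁻¹ := by rw [← hpq.inv_add_inv_eq_one]; ring
  rw [div_eq_mul_inv _ q, hq] at hle
  have h4 : (∫ x in box l, ‖φ x‖ ^ p) / p ≤ r ^ p * (∫ x in box l, ‖gradient φ x‖ ^ p) / p := by
    rw [div_eq_mul_inv]; linarith
  exact (div_le_div_iff_of_pos_right hp0).1 h4

end Box


/-! ### The gradient of the `p`-th power of the norm. -/

section NormPow

variable {F : Type*} [NormedAddCommGroup F] [InnerProductSpace ℝ F] {p q : ℝ}

theorem norm_rpow_sub_two_mul_inner_self (hp : 1 < p) (c : F) :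
    ‖c‖ ^ (p - 2) * inner ℝ c c = ‖c‖ ^ p := by
  rw [real_inner_self_eq_norm_sq]
  rcases (norm_nonneg c).eq_or_lt with h | h
  · rw [← h, Real.zero_rpow (by linarith : p ≠ 0)]; simp
  · rw [← Real.rpow_natCast, ← Real.rpow_add h]; congr 1; push_cast; ring

theorem abs_norm_rpow_mul_inner_le (hp : 1 < p) (c a : F) :
    |‖c‖ ^ (p - 2) * inner ℝ c a| ≤ ‖c‖ ^ (p - 1) * ‖a‖ := by
  rw [abs_mul, abs_of_nonneg (by positivity)]
  refine (mul_le_mul_of_nonneg_left (abs_real_inner_le_norm c a) (by positivity)).trans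
    (le_of_eq ?_)
  rcases (norm_nonneg c).eq_or_lt with h | h
  · rw [← h, Real.zero_rpow (by linarith : p - 1 ≠ 0)]; simp
  · rw [← mul_assoc, ← Real.rpow_add_one h.ne']; congr 2; ring

/-- The gradient inequality for the convex function `‖·‖ ^ p / p`. -/
theorem norm_rpow_div_add_le (hpq : p.HolderConjugate q) (c a : F) :
    ‖c‖ ^ p / p + ‖c‖ ^ (p - 2) * inner ℝ c (a - c) ≤ ‖a‖ ^ p / p := by
  have h1 := (le_abs_self _).trans (abs_norm_rpow_mul_inner_le hpq.lt c a)
  have h2 := Real.young_inequality_of_nonneg (a := ‖c‖ ^ (p - 1)) (b := ‖a‖) (by positivity)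
    (norm_nonneg a) hpq.symm
  rw [← Real.rpow_mul (norm_nonneg _), hpq.sub_one_mul_conj] at h2
  rw [inner_sub_right, mul_sub, norm_rpow_sub_two_mul_inner_self hpq.lt]
  have hq : q⁻¹ = 1 - p⁻¹ := by rw [← hpq.inv_add_inv_eq_one]; ring
  simp only [div_eq_mul_inv, hq] at h2 ⊢
  linarith

/-- For `p < 2` the factor `‖c‖ ^ (p - 2)` is singular at `0`; continuity is read off from the `C^1`
function `‖·‖ ^ p / p`, whose derivative in direction `a` this is. -/
theorem continuous_norm_rpow_mul_inner (hp : 1 < p) (a : F) :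
    Continuous fun c : F => ‖c‖ ^ (p - 2) * inner ℝ c a := by
  have h := ((contDiff_norm_rpow (E := F) hp).continuous_fderiv one_ne_zero).clm_apply
    (continuous_const (y := a))
  have h2 := h.const_smul p⁻¹
  refine h2.congr fun c => ?_
  have hp0 : p ≠ 0 := by linarith
  simp only [Pi.smul_apply, fderiv_norm_rpow c hp, smul_eq_mul, _root_.smul_apply, innerSL_apply_apply]
  field_simp

end NormPow

/-! ### Existence of the torsion function by minimizing the energy. -/

section Existence

variable {l : Fin D → ℝ} {p q : ℝ}

/-- The energy `∫ ‖∇φ‖ ^ p / p - ∫ φ` whose minimizer is the torsion function. -/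
def energy (p : ℝ) (Ω : Set (E D)) (φ : E D → ℝ) : ℝ :=
  (∫ x in Ω, ‖gradient φ x‖ ^ p) / p - ∫ x in Ω, φ x

theorem exists_energy_coercive (hpq : p.HolderConjugate q) (l : Fin D → ℝ) (i : Fin D) :
    ∃ C : ℝ, ∀ φ : E D → ℝ, IsTestFunction (box l) φ →
      (∫ x in box l, ‖gradient φ x‖ ^ p) / (2 * p) - C ≤ energy p (box l) φ := by
  have hp0 : 0 < p := by linarith [hpq.lt]
  -- Young is applied to `s σ` and `s⁻¹ ∇φ`; as `s ^ p = 2`, only half of the gradient energy is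
  -- spent on bounding `∫ φ`.
  set s : ℝ := 2 ^ p⁻¹ with hs
  have hs0 : 0 < s := by positivity
  have hsp : s ^ p = 2 := Real.rpow_inv_rpow zero_le_two hp0.ne'
  refine ⟨(∫ x in box l, ‖s • coordField i (l i / 2) x‖ ^ q) / q, fun φ h => ?_⟩
  have h1 := integral_inner_le_young hpq ((memLp_coordField l i (ENNReal.ofReal q)).const_smul s)
    ((h.memLp_gradient (ENNReal.ofReal p) (box l)).const_smul s⁻¹)
  have h2 : ∀ x, inner ℝ ((s • coordField i (l i / 2)) x) ((s⁻¹ • gradient φ) x)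
      = inner ℝ (coordField i (l i / 2) x) (gradient φ x) := fun x => by
    rw [Pi.smul_apply, Pi.smul_apply, real_inner_smul_left, real_inner_smul_right,
      mul_inv_cancel_left₀ hs0.ne']
  have h3 : ∀ x, ‖(s⁻¹ • gradient φ) x‖ ^ p = 2⁻¹ * ‖gradient φ x‖ ^ p := fun x => by
    rw [Pi.smul_apply, norm_smul, Real.norm_of_nonneg (by positivity),
      Real.mul_rpow (by positivity) (norm_nonneg _), Real.inv_rpow hs0.le, hsp]
  simp only [h2, h3, integral_const_mul] at h1
  rw [← h.integral_eq i] at h1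
  have h4 : (∫ x in box l, ‖gradient φ x‖ ^ p) / (2 * p)
      = 2⁻¹ * ((∫ x in box l, ‖gradient φ x‖ ^ p) / p) := by rw [mul_comm, ← div_div]; ring
  rw [mul_div_assoc] at h1
  simp only [energy, Pi.smul_apply] at *
  linarith

/-- The linear part of the energy cancels at the midpoint. For two nearly minimizing functions the
right side is small, which bounds the defect of their gradients. -/
theorem integral_convexityDefect_eq (hp : 1 < p) {φ ψ : E D → ℝ}
    (h : IsTestFunction (box l) φ) (h' : IsTestFunction (box l) ψ) :
    ∫ x in box l, convexityDefect p (gradient φ x) (gradient ψ x)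
      = p * ((energy p (box l) φ + energy p (box l) ψ) / 2
        - energy p (box l) ((2⁻¹ : ℝ) • (φ + ψ))) := by
  have hp0 : p ≠ 0 := by linarith
  have i1 := integrable_norm_rpow_of_memLp hp (h.memLp_gradient (ENNReal.ofReal p) (box l))
  have i2 := integrable_norm_rpow_of_memLp hp (h'.memLp_gradient (ENNReal.ofReal p) (box l))
  have i3 := integrable_norm_rpow_of_memLp hp
    (((h.add h').smul 2⁻¹).memLp_gradient (ENNReal.ofReal p) (box l))
  have e3 : ∀ x, gradient ((2⁻¹ : ℝ) • (φ + ψ)) x = (2⁻¹ : ℝ) • (gradient φ x + gradient ψ x) :=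
    fun x => by rw [(h.add h').gradient_smul, h.gradient_add h']
  have e4 : ∫ x in box l, ((2⁻¹ : ℝ) • (φ + ψ)) x
      = 2⁻¹ * ((∫ x in box l, φ x) + ∫ x in box l, ψ x) := by
    rw [← integral_add (memLp_one_iff_integrable.1 (h.memLp 1 _))
      (memLp_one_iff_integrable.1 (h'.memLp 1 _)), ← integral_const_mul]
    rfl
  simp only [e3] at i3
  simp only [energy, convexityDefect, e3, e4]
  have i12 : Integrable (fun x => (‖gradient φ x‖ ^ p + ‖gradient ψ x‖ ^ p) / 2)
    (volume.restrict (box l)) := (i1.add i2).div_const 2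
  rw [integral_sub i12 i3, integral_div, integral_add i1 i2]
  field_simp
  ring

/-- The limit is the energy of `u + tψ` written with the Sobolev gradient `g`, since `gradient u`
itself has no meaning for a mere `L^p` limit. -/
theorem tendsto_energy_add_smul (hpq : p.HolderConjugate q) {u : E D → ℝ} {g : E D → E D}
    (hu : MemLp u (ENNReal.ofReal p) (volume.restrict (box l)))
    (hg : MemLp g (ENNReal.ofReal p) (volume.restrict (box l)))
    {φ : ℕ → E D → ℝ} (hφ : ∀ n, IsTestFunction (box l) (φ n))
    (hφu : Tendsto (fun n => eLpNorm (fun x => φ n x - u x) (ENNReal.ofReal p)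
      (volume.restrict (box l))) atTop (𝓝 0))
    (hφg : Tendsto (fun n => eLpNorm (fun x => gradient (φ n) x - g x) (ENNReal.ofReal p)
      (volume.restrict (box l))) atTop (𝓝 0))
    {ψ : E D → ℝ} (hψ : IsTestFunction (box l) ψ) (t : ℝ) :
    Tendsto (fun n => energy p (box l) (φ n + t • ψ)) atTop
      (𝓝 ((∫ x in box l, ‖g x + t • gradient ψ x‖ ^ p) / p
        - ((∫ x in box l, u x) + t * ∫ x in box l, ψ x))) := by
  have := isFiniteMeasure_restrict_box l
  have e : ∀ n x, gradient (φ n + t • ψ) x = gradient (φ n) x + t • gradient ψ x := fun n x => by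
    rw [(hφ n).gradient_add (hψ.smul t), hψ.gradient_smul]
  have hψg := (hψ.memLp_gradient (ENNReal.ofReal p) (box l)).const_smul t
  have h1 : Tendsto (fun n => ∫ x in box l, ‖gradient (φ n) x + t • gradient ψ x‖ ^ p) atTop
      (𝓝 (∫ x in box l, ‖g x + t • gradient ψ x‖ ^ p)) := by
    refine tendsto_integral_norm_rpow hpq.lt
      (fun n => ((hφ n).memLp_gradient (ENNReal.ofReal p) (box l)).add hψg) (hg.add hψg) ?_
    simpa using hφg
  have h2 : Tendsto (fun n => ∫ x in box l, φ n x) atTop (𝓝 (∫ x in box l, u x)) := by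
    simpa using tendsto_integral_inner hpq (k := fun _ => (1 : ℝ)) (memLp_const 1)
      (fun n => (hφ n).memLp (ENNReal.ofReal p) (box l)) hu hφu
  refine ((h1.div_const p).sub (h2.add_const (t * ∫ x in box l, ψ x))).congr fun n => ?_
  simp only [energy, e]
  congr 1
  rw [← integral_const_mul, ← integral_add (memLp_one_iff_integrable.1 ((hφ n).memLp 1 _))
      ((memLp_one_iff_integrable.1 (hψ.memLp 1 _)).const_mul t)]
  rfl

theorem tendsto_integral_norm_rpow_mul_inner {α F : Type*} [MeasurableSpace α] {μ : Measure α}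
    [NormedAddCommGroup F] [InnerProductSpace ℝ F] (hp : 1 < p) {g k : α → F}
    (hg : MemLp g (ENNReal.ofReal p) μ) (hk : MemLp k (ENNReal.ofReal p) μ)
    {t : ℕ → ℝ} (ht : ∀ n, |t n| ≤ 1) (ht0 : Tendsto t atTop (𝓝 0)) :
    Tendsto (fun n => ∫ x, ‖g x + t n • k x‖ ^ (p - 2) * inner ℝ (g x + t n • k x) (k x) ∂μ)
      atTop (𝓝 (∫ x, ‖g x‖ ^ (p - 2) * inner ℝ (g x) (k x) ∂μ)) := by
  refine tendsto_integral_of_dominated_convergence (fun x => ‖‖g x‖ + ‖k x‖‖ ^ p) (fun n => ?_)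
    (integrable_norm_rpow_of_memLp hp (hg.norm.add hk.norm)) (fun n => ae_of_all _ fun x => ?_)
    (ae_of_all _ fun x => ?_)
  · have h1 := hg.1.add (hk.1.const_smul (t n))
    exact (h1.norm.aemeasurable.pow_const (p - 2)).aestronglyMeasurable.mul (h1.inner hk.1)
  · rw [Real.norm_eq_abs, Real.norm_of_nonneg (by positivity)]
    refine (abs_norm_rpow_mul_inner_le hp _ _).trans ?_
    have h1 : ‖g x + t n • k x‖ ≤ ‖g x‖ + ‖k x‖ := by
      refine (norm_add_le _ _).trans (add_le_add_right ?_ _)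
      rw [norm_smul]
      exact mul_le_of_le_one_left (norm_nonneg _) (ht n)
    have h2 : ‖g x + t n • k x‖ ^ (p - 1) ≤ (‖g x‖ + ‖k x‖) ^ (p - 1) :=
      Real.rpow_le_rpow (norm_nonneg _) h1 (by linarith)
    have h3 : ‖k x‖ ≤ ‖g x‖ + ‖k x‖ := by linarith [norm_nonneg (g x)]
    refine (mul_le_mul h2 h3 (norm_nonneg _) (by positivity)).trans (le_of_eq ?_)
    have h4 : 0 ≤ ‖g x‖ + ‖k x‖ := by positivity
    rcases h4.eq_or_lt with h | h
    · rw [← h, Real.zero_rpow (by linarith : p ≠ 0), mul_zero]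
    · rw [← Real.rpow_add_one h.ne']; congr 1; ring
  · have h1 : Tendsto (fun n => g x + t n • k x) atTop (𝓝 (g x)) := by
      simpa using (ht0.smul_const (k x)).const_add (g x)
    exact ((continuous_norm_rpow_mul_inner hp (k x)).tendsto (g x)).comp h1

theorem isTorsionFunction_of_tendsto_minimizing (hpq : p.HolderConjugate q) {u : E D → ℝ}
    {g : E D → E D} (hu : MemLp u (ENNReal.ofReal p) (volume.restrict (box l)))
    (hg : MemLp g (ENNReal.ofReal p) (volume.restrict (box l)))
    {φ : ℕ → E D → ℝ} (hφ : ∀ n, IsTestFunction (box l) (φ n))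
    (hφu : Tendsto (fun n => eLpNorm (fun x => φ n x - u x) (ENNReal.ofReal p)
      (volume.restrict (box l))) atTop (𝓝 0))
    (hφg : Tendsto (fun n => eLpNorm (fun x => gradient (φ n) x - g x) (ENNReal.ofReal p)
      (volume.restrict (box l))) atTop (𝓝 0))
    {m : ℝ} (hm : ∀ ψ, IsTestFunction (box l) ψ → m ≤ energy p (box l) ψ)
    (hφm : Tendsto (fun n => energy p (box l) (φ n)) atTop (𝓝 m)) :
    IsTorsionFunction p (box l) u := by
  have hp := hpq.lt
  refine ⟨g, ⟨hu, hg, φ, hφ, hφu, hφg⟩, ?_⟩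
  have hmin : (∫ x in box l, ‖g x‖ ^ p) / p - ∫ x in box l, u x = m := by
    refine tendsto_nhds_unique ?_ hφm
    simpa using tendsto_energy_add_smul hpq hu hg hφ hφu hφg
      (isTestFunction_zero (Ω := box l)) 0
  have key : ∀ ψ : E D → ℝ, IsTestFunction (box l) ψ →
      ∫ x in box l, ψ x ≤ ∫ x in box l, ‖g x‖ ^ (p - 2) * inner ℝ (g x) (gradient ψ x) := by
    intro ψ hψ
    have hk := hψ.memLp_gradient (ENNReal.ofReal p) (box l)
    refine ge_of_tendsto (tendsto_integral_norm_rpow_mul_inner hp hg hk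
      (t := fun n => 1 / ((n : ℝ) + 1)) (fun n => ?_) tendsto_one_div_add_atTop_nhds_zero_nat)
      (Eventually.of_forall fun n => ?_)
    · rw [abs_of_nonneg (by positivity), div_le_one (by positivity)]
      linarith [n.cast_nonneg (α := ℝ)]
    set t : ℝ := 1 / ((n : ℝ) + 1) with ht
    have ht0 : 0 < t := by positivity
    have hgt : MemLp (fun x => g x + t • gradient ψ x) (ENNReal.ofReal p)
      (volume.restrict (box l)) := hg.add (hk.const_smul t)
    have h1 : m ≤ (∫ x in box l, ‖g x + t • gradient ψ x‖ ^ p) / p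
        - ((∫ x in box l, u x) + t * ∫ x in box l, ψ x) :=
      ge_of_tendsto' (tendsto_energy_add_smul hpq hu hg hφ hφu hφg hψ t)
        fun n => hm _ ((hφ n).add (hψ.smul t))
    have i1 := integrable_norm_rpow_of_memLp hp hgt
    have i2 := integrable_norm_rpow_of_memLp hp hg
    have i3 : Integrable (fun x => ‖g x + t • gradient ψ x‖ ^ (p - 2) *
        inner ℝ (g x + t • gradient ψ x) (gradient ψ x)) (volume.restrict (box l)) := by
      simpa only [real_inner_smul_left] using
        integrable_inner_of_memLp hpq (memLp_norm_rpow_smul hpq hgt) hk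
    -- The gradient inequality is used at the perturbed point, so minimality bounds `∫ ψ` by the
    -- flux at `g + t∇ψ` for each `t > 0`; letting `t → 0` then requires no differentiation under
    -- the integral.
    have h2 : ∫ x in box l, (‖g x + t • gradient ψ x‖ ^ p / p -
        t * (‖g x + t • gradient ψ x‖ ^ (p - 2) *
          inner ℝ (g x + t • gradient ψ x) (gradient ψ x)))
        ≤ ∫ x in box l, ‖g x‖ ^ p / p := by
      refine integral_mono ((i1.div_const p).sub (i3.const_mul t)) (i2.div_const p) fun x => ?_
      have := norm_rpow_div_add_le hpq (g x + t • gradient ψ x) (g x)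
      rw [sub_add_cancel_left, inner_neg_right, real_inner_smul_right] at this
      simp only
      linarith
    rw [integral_sub (i1.div_const p) (i3.const_mul t), integral_div, integral_div,
      integral_const_mul] at h2
    refine le_of_mul_le_mul_left ?_ ht0
    linarith
  intro ψ hψ
  refine le_antisymm ?_ (key ψ hψ)
  have h := key _ (hψ.smul (-1))
  simp only [hψ.gradient_smul, Pi.smul_apply, smul_eq_mul, neg_mul, one_mul, real_inner_smul_right,
    mul_neg, integral_neg] at h
  linarith

/-- Strong convergence is obtained directly: the gradients of a minimizing sequence are Cauchy in
`L^p` by uniform convexity, and the functions are then Cauchy by Poincaré. No weak compactness is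
needed. -/
theorem exists_isTorsionFunction (hpq : p.HolderConjugate q) (l : Fin D → ℝ) (i : Fin D) :
    ∃ u, IsTorsionFunction p (box l) u := by
  have hp := hpq.lt
  have hp0 : 0 < p := by linarith
  obtain ⟨C, hC⟩ := exists_energy_coercive hpq l i
  set S : Set ℝ := energy p (box l) '' {φ | IsTestFunction (box l) φ}
  have hSne : S.Nonempty := ⟨_, 0, isTestFunction_zero, rfl⟩
  have hSbdd : BddBelow S := ⟨-C, by
    rintro _ ⟨φ, h, rfl⟩
    have h1 := hC φ h
    have h2 : 0 ≤ (∫ x in box l, ‖gradient φ x‖ ^ p) / (2 * p) :=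
      div_nonneg (integral_nonneg fun x => by positivity) (by positivity)
    linarith⟩
  set m := sInf S
  have hm : ∀ ψ, IsTestFunction (box l) ψ → m ≤ energy p (box l) ψ := fun ψ hψ =>
    csInf_le hSbdd ⟨ψ, hψ, rfl⟩
  have hex : ∀ n : ℕ, ∃ φ, IsTestFunction (box l) φ ∧ energy p (box l) φ < m + 1 / ((n : ℝ) + 1) :=
    fun n => by
      obtain ⟨_, ⟨φ, h, rfl⟩, h'⟩ := exists_lt_of_csInf_lt hSne
        (show m < m + 1 / ((n : ℝ) + 1) by linarith [show 0 < 1 / ((n : ℝ) + 1) by positivity])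
      exact ⟨φ, h, h'⟩
  choose φ hφ hφlt using hex
  have hlim : Tendsto (fun n : ℕ => 1 / ((n : ℝ) + 1)) atTop (𝓝 0) :=
    tendsto_one_div_add_atTop_nhds_zero_nat
  have hφm : Tendsto (fun n => energy p (box l) (φ n)) atTop (𝓝 m) :=
    tendsto_of_tendsto_of_tendsto_of_le_of_le tendsto_const_nhds
      (by simpa using hlim.const_add m) (fun n => hm _ (hφ n)) fun n => (hφlt n).le
  set K : ℝ := 2 * p * (m + 1 + C)
  have hK : ∀ n, ∫ x in box l, ‖gradient (φ n) x‖ ^ p ≤ K := fun n => by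
    have h1 := hC _ (hφ n)
    have h2 := hφlt n
    have h3 : 1 / ((n : ℝ) + 1) ≤ 1 := by
      rw [div_le_one (by positivity)]; linarith [n.cast_nonneg (α := ℝ)]
    have h4 : (∫ x in box l, ‖gradient (φ n) x‖ ^ p) / (2 * p) ≤ m + 1 + C := by linarith
    rw [div_le_iff₀ (by positivity)] at h4
    exact h4.trans (le_of_eq (by ring))
  have hK0 : 0 ≤ K := (integral_nonneg fun x => by positivity).trans (hK 0)
  have hgn : ∀ n, MemLp (gradient (φ n)) (ENNReal.ofReal p) (volume.restrict (box l)) :=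
    fun n => (hφ n).memLp_gradient _ _
  have hcauchy : ∀ ε > 0, ∃ N, ∀ a ≥ N, ∀ b ≥ N,
      ∫ x in box l, ‖gradient (φ a) x - gradient (φ b) x‖ ^ p < ε := by
    intro ε hε
    -- The two gradient integrals sum to at most `2(K+1)`, so this coefficient contributes `ε/2`;
    -- `N` is chosen so that the energy gap, multiplied by `A p`, contributes less than `ε/2`.
    obtain ⟨A, hA, hAle⟩ := exists_norm_sub_rpow_le (F := E D) hp
      (ε := ε / (4 * (K + 1))) (by positivity)
    obtain ⟨N, hN⟩ := eventually_atTop.1 (hlim.eventually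
      (gt_mem_nhds (show 0 < ε / (2 * (A * p)) by positivity)))
    refine ⟨N, fun a ha b hb => ?_⟩
    have i1 := integrable_norm_rpow_of_memLp hp (hgn a)
    have i2 := integrable_norm_rpow_of_memLp hp (hgn b)
    have i3 := integrable_norm_rpow_of_memLp hp (((hgn a).add (hgn b)).const_smul (2⁻¹ : ℝ))
    have i4 : Integrable (fun x => convexityDefect p (gradient (φ a) x) (gradient (φ b) x))
      (volume.restrict (box l)) := ((i1.add i2).div_const 2).sub i3
    have i12 : Integrable (fun x => ε / (4 * (K + 1)) *
        (‖gradient (φ a) x‖ ^ p + ‖gradient (φ b) x‖ ^ p)) (volume.restrict (box l)) :=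
      (i1.add i2).const_mul _
    have h1 : ∫ x in box l, ‖gradient (φ a) x - gradient (φ b) x‖ ^ p
        ≤ ∫ x in box l, (ε / (4 * (K + 1)) * (‖gradient (φ a) x‖ ^ p + ‖gradient (φ b) x‖ ^ p)
          + A * convexityDefect p (gradient (φ a) x) (gradient (φ b) x)) :=
      integral_mono (integrable_norm_rpow_of_memLp hp ((hgn a).sub (hgn b)))
        (i12.add (i4.const_mul A)) fun x => hAle _ _
    rw [integral_add i12 (i4.const_mul A), integral_const_mul,
      integral_const_mul, integral_add i1 i2, integral_convexityDefect_eq hp (hφ a) (hφ b)] at h1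
    have h2 := hm _ (((hφ a).add (hφ b)).smul 2⁻¹)
    have h3 : (energy p (box l) (φ a) + energy p (box l) (φ b)) / 2
        - energy p (box l) ((2⁻¹ : ℝ) • (φ a + φ b)) < ε / (2 * (A * p)) := by
      linarith [hφlt a, hφlt b, hN a ha, hN b hb]
    have h4 : ε / (4 * (K + 1)) * ((∫ x in box l, ‖gradient (φ a) x‖ ^ p)
        + ∫ x in box l, ‖gradient (φ b) x‖ ^ p) ≤ ε / (4 * (K + 1)) * (2 * (K + 1)) :=
      mul_le_mul_of_nonneg_left (by linarith [hK a, hK b]) (by positivity)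
    have h5 : ε / (4 * (K + 1)) * (2 * (K + 1)) = ε / 2 := by field_simp; ring
    have h6 : A * (p * ((energy p (box l) (φ a) + energy p (box l) (φ b)) / 2
        - energy p (box l) ((2⁻¹ : ℝ) • (φ a + φ b)))) < ε / 2 := by
      rw [← mul_assoc]
      refine (mul_lt_mul_of_pos_left h3 (by positivity)).trans_le (le_of_eq ?_)
      field_simp
    linarith
  obtain ⟨g, hg, hφg⟩ := exists_memLp_tendsto hp hgn hcauchy
  obtain ⟨u, hu, hφu⟩ := exists_memLp_tendsto hp
    (fun n => (hφ n).memLp (ENNReal.ofReal p) (box l)) (by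
      intro ε hε
      set B : ℝ := (p * (l i / 2)) ^ p
      obtain ⟨N, hN⟩ := hcauchy (ε / (|B| + 1)) (by positivity)
      refine ⟨N, fun a ha b hb => ?_⟩
      have h1 := ((hφ a).sub (hφ b)).integral_norm_rpow_le hpq i
      simp only [(hφ a).gradient_sub (hφ b), Pi.sub_apply] at h1
      have h2 := hN a ha b hb
      have h3 : 0 ≤ ∫ x in box l, ‖gradient (φ a) x - gradient (φ b) x‖ ^ p :=
        integral_nonneg fun x => by positivity
      rw [lt_div_iff₀ (by positivity)] at h2
      nlinarith [le_abs_self B])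
  exact ⟨u, isTorsionFunction_of_tendsto_minimizing hpq hu hg hφ hφu hφg hm hφm⟩

end Existence


/-! ### Upper bound for the torsional rigidity. -/

section TorsionBounds

variable {l : Fin D → ℝ} {p q : ℝ} {u : E D → ℝ}

/-- Lets `u` itself be used as a test function, both for its own flux and for the coordinate fields.
-/
theorem IsSobolevZero.integral_eq (hpq : p.HolderConjugate q) {g : E D → E D}
    (hu : IsSobolevZero p (box l) u g)
    {k : E D → E D} (hk : MemLp k (ENNReal.ofReal q) (volume.restrict (box l)))
    (h : ∀ φ, IsTestFunction (box l) φ →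
      ∫ x in box l, inner ℝ (k x) (gradient φ x) = ∫ x in box l, φ x) :
    ∫ x in box l, u x = ∫ x in box l, inner ℝ (k x) (g x) := by
  obtain ⟨hu, hg, φ, hφ, hφu, hφg⟩ := hu
  have := isFiniteMeasure_restrict_box l
  have h1 : Tendsto (fun n => ∫ x in box l, φ n x) atTop (𝓝 (∫ x in box l, u x)) := by
    simpa using tendsto_integral_inner hpq (k := fun _ => (1 : ℝ)) (memLp_const 1)
      (fun n => (hφ n).memLp (ENNReal.ofReal p) (box l)) hu hφu
  have h2 := tendsto_integral_inner hpq hk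
    (fun n => (hφ n).memLp_gradient (ENNReal.ofReal p) (box l)) hg hφg
  exact tendsto_nhds_unique h1 (h2.congr fun n => h _ (hφ n))

theorem IsTorsionFunction.exists_gradient (hpq : p.HolderConjugate q)
    (hu : IsTorsionFunction p (box l) u) :
    ∃ g : E D → E D, MemLp g (ENNReal.ofReal p) (volume.restrict (box l)) ∧
      (∫ x in box l, u x = ∫ x in box l, ‖g x‖ ^ p) ∧
      (∀ i, ∫ x in box l, u x = ∫ x in box l, inner ℝ (coordField i (l i / 2) x) (g x)) ∧
      ∀ φ, IsTestFunction (box l) φ →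
        ∫ x in box l, φ x ≤ (∫ x in box l, u x) / q + (∫ x in box l, ‖gradient φ x‖ ^ p) / p := by
  obtain ⟨g, hs, hw⟩ := hu
  have hk := memLp_norm_rpow_smul hpq hs.2.1
  have hw' : ∀ φ, IsTestFunction (box l) φ →
      ∫ x in box l, inner ℝ (‖g x‖ ^ (p - 2) • g x) (gradient φ x) = ∫ x in box l, φ x := by
    simpa only [real_inner_smul_left] using hw
  have hT : ∫ x in box l, u x = ∫ x in box l, ‖g x‖ ^ p := by
    rw [hs.integral_eq hpq hk hw']
    simp only [real_inner_smul_left, norm_rpow_sub_two_mul_inner_self hpq.lt]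
  refine ⟨g, hs.2.1, hT, fun i => ?_, fun φ hφ => ?_⟩
  · exact hs.integral_eq hpq (memLp_coordField l i _) fun φ hφ => (hφ.integral_eq i _).symm
  · have h := integral_inner_le_young hpq hk (hφ.memLp_gradient (ENNReal.ofReal p) (box l))
    simpa only [hw' φ hφ, norm_norm_rpow_smul_rpow hpq, ← hT] using h

theorem IsTorsionFunction.integral_nonneg (hpq : p.HolderConjugate q)
    (hu : IsTorsionFunction p (box l) u) : 0 ≤ ∫ x in box l, u x := by
  obtain ⟨g, -, hT, -⟩ := hu.exists_gradient hpq
  rw [hT]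
  exact MeasureTheory.integral_nonneg fun x => by positivity

/-- Since `T = ∫ ‖g‖^p = ∫ ⟨σ, g⟩`, Young gives `T ≤ (∫ ‖σ‖^q)/q + T/p`, and `1 - 1/p = 1/q`. -/
theorem IsTorsionFunction.integral_le_integral_coordField (hpq : p.HolderConjugate q)
    (hu : IsTorsionFunction p (box l) u) (i : Fin D) :
    ∫ x in box l, u x ≤ ∫ x in box l, ‖coordField i (l i / 2) x‖ ^ q := by
  obtain ⟨g, hg, hT, hσ, -⟩ := hu.exists_gradient hpq
  have h := integral_inner_le_young hpq (memLp_coordField l i (ENNReal.ofReal q)) hg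
  rw [← hσ i, ← hT] at h
  have hq : p⁻¹ = 1 - q⁻¹ := by rw [← hpq.inv_add_inv_eq_one]; ring
  rw [div_eq_mul_inv _ p, hq] at h
  have hq0 : 0 < q := by linarith [hpq.symm.lt]
  refine (div_le_div_iff_of_pos_right hq0).1 ?_
  rw [div_eq_mul_inv (∫ x in box l, u x)]
  linarith

theorem integral_coord_box (i : Fin D) {l : Fin D → ℝ} (hl : ∀ i, 0 < l i) (h : ℝ → ℝ) :
    ∫ x in box l, h (x i) = (∫ t in (0 : ℝ)..l i, h t) * (volume.real (box l) / l i) := by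
  have e : box l = WithLp.ofLp ⁻¹' (Set.univ.pi fun i => Set.Ioo 0 (l i)) := by
    ext x; simp [box]
  have h1 : ∫ x in box l, h (x i)
      = ∫ y in Set.univ.pi fun i => Set.Ioo 0 (l i), h (y i) := by
    rw [e]
    exact (PiLp.volume_preserving_ofLp (Fin D)).setIntegral_preimage_emb
      (MeasurableEquiv.toLp 2 (Fin D → ℝ)).symm.measurableEmbedding (fun y => h (y i)) _
  rw [h1, volume_pi, Measure.restrict_pi_pi]
  -- Written as a product over all coordinates, the integrand fits Fubini for finite products.
  have h2 : ∀ y : Fin D → ℝ, h (y i) = ∏ j, (if j = i then h (y j) else 1) := fun y => by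
    rw [Finset.prod_ite_eq' Finset.univ i fun j => h (y j)]; simp
  simp only [h2]
  rw [integral_fintype_prod_eq_prod (fun j t => if j = i then h t else 1),
    ← Finset.mul_prod_erase _ _ (Finset.mem_univ i)]
  simp only [if_true]
  congr 1
  · rw [intervalIntegral.integral_of_le (hl i).le, integral_Ioc_eq_integral_Ioo]
  · rw [volumeReal_box hl, ← Finset.mul_prod_erase _ _ (Finset.mem_univ i),
      mul_div_cancel_left₀ _ (hl i).ne']
    refine Finset.prod_congr rfl fun j hj => ?_
    simp [(Finset.mem_erase.1 hj).1, (hl j).le]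

theorem integral_abs_sub_rpow {R q : ℝ} (hR : 0 < R) (hq : 1 < q) :
    ∫ t in (0 : ℝ)..2 * R, |R - t| ^ q = 2 * R * (R ^ q / (q + 1)) := by
  have hc : Continuous fun t : ℝ => |R - t| ^ q :=
    (continuous_const.sub continuous_id).abs.rpow_const fun _ => Or.inr (by linarith)
  have hp : ∫ t in (0 : ℝ)..R, t ^ q = R * (R ^ q / (q + 1)) := by
    rw [integral_rpow (Or.inl (by linarith)), Real.zero_rpow (by linarith), sub_zero,
      Real.rpow_add_one hR.ne']
    ring
  have h1 : ∫ t in (0 : ℝ)..R, |R - t| ^ q = R * (R ^ q / (q + 1)) := by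
    rw [← hp, intervalIntegral.integral_comp_sub_left (fun t => |t| ^ q) R, sub_self, sub_zero]
    refine intervalIntegral.integral_congr fun t ht => ?_
    rw [Set.uIcc_of_le hR.le] at ht
    simp only [abs_of_nonneg ht.1]
  have h2 : ∫ t in R..2 * R, |R - t| ^ q = R * (R ^ q / (q + 1)) := by
    rw [← hp, ← sub_self R, show 2 * R = R + R by ring]
    have := intervalIntegral.integral_comp_sub_right (a := R) (b := R + R) (fun t => |t| ^ q) R
    simp only [abs_sub_comm R]
    rw [this, add_sub_cancel_right]
    refine intervalIntegral.integral_congr fun t ht => ?_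
    rw [sub_self, Set.uIcc_of_le hR.le] at ht
    simp only [abs_of_nonneg ht.1]
  rw [← intervalIntegral.integral_add_adjacent_intervals (hc.intervalIntegrable 0 R)
    (hc.intervalIntegrable R (2 * R)), h1, h2]
  ring

theorem IsTorsionFunction.integral_le (hpq : p.HolderConjugate q)
    (hu : IsTorsionFunction p (box l) u) (hl : ∀ i, 0 < l i) {R : ℝ} {i : Fin D}
    (hi : l i = 2 * R) :
    ∫ x in box l, u x ≤ volume.real (box l) * R ^ q / (q + 1) := by
  have hR : 0 < R := by linarith [hl i]
  refine (hu.integral_le_integral_coordField hpq i).trans (le_of_eq ?_)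
  simp only [norm_coordField]
  rw [integral_coord_box i hl fun t => |l i / 2 - t| ^ q, hi, mul_div_cancel_left₀ R two_ne_zero,
    integral_abs_sub_rpow hR hpq.symm.lt]
  field_simp

end TorsionBounds


/-! ### Smooth approximation of the distance to the faces. -/

section SoftMin

/-- The sum of `exp (-N s)` over the signed distances `s` of `x` to the faces of the box. -/
def expSum (l : Fin D → ℝ) (N : ℝ) (x : E D) : ℝ :=
  ∑ i, (Real.exp (-(N * x i)) + Real.exp (-(N * (l i - x i))))

/-- A smooth approximation from below of the distance to the boundary of the box. -/
def softMin (l : Fin D → ℝ) (N : ℝ) (x : E D) : ℝ :=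
  -(Real.log (expSum l N x) / N)

/-- The smallest signed distance of `x` to the faces of the box. -/
def faceDist [NeZero D] (l : Fin D → ℝ) (x : E D) : ℝ :=
  Finset.univ.inf' Finset.univ_nonempty fun i => min (x i) (l i - x i)

variable {l : Fin D → ℝ} {N : ℝ}

theorem exp_lt_expSum_left (l : Fin D → ℝ) (N : ℝ) (x : E D) (i : Fin D) :
    Real.exp (-(N * x i)) < expSum l N x := by
  refine lt_of_lt_of_le (lt_add_of_pos_right _ (Real.exp_pos (-(N * (l i - x i))))) ?_
  exact Finset.single_le_sum
    (f := fun i => Real.exp (-(N * x i)) + Real.exp (-(N * (l i - x i))))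
    (fun j _ => by positivity) (Finset.mem_univ i)

theorem exp_lt_expSum_right (l : Fin D → ℝ) (N : ℝ) (x : E D) (i : Fin D) :
    Real.exp (-(N * (l i - x i))) < expSum l N x := by
  refine lt_of_lt_of_le (lt_add_of_pos_left _ (Real.exp_pos (-(N * x i)))) ?_
  exact Finset.single_le_sum
    (f := fun i => Real.exp (-(N * x i)) + Real.exp (-(N * (l i - x i))))
    (fun j _ => by positivity) (Finset.mem_univ i)

theorem expSum_pos [NeZero D] (l : Fin D → ℝ) (N : ℝ) (x : E D) : 0 < expSum l N x :=
  (Real.exp_pos _).trans (exp_lt_expSum_left l N x 0)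

theorem softMin_lt_of_exp_lt (hN : 0 < N) {x : E D} {s : ℝ}
    (h : Real.exp (-(N * s)) < expSum l N x) : softMin l N x < s := by
  have := (Real.lt_log_iff_exp_lt ((Real.exp_pos _).trans h)).2 h
  rw [softMin, neg_lt, lt_div_iff₀ hN]
  linarith

theorem softMin_lt_left (hN : 0 < N) (x : E D) (i : Fin D) : softMin l N x < x i :=
  softMin_lt_of_exp_lt hN (exp_lt_expSum_left l N x i)

theorem softMin_lt_right (hN : 0 < N) (x : E D) (i : Fin D) : softMin l N x < l i - x i :=
  softMin_lt_of_exp_lt hN (exp_lt_expSum_right l N x i)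

theorem softMin_lt (hN : 0 < N) (x : E D) {i : Fin D} {R : ℝ} (hi : l i = 2 * R) :
    softMin l N x < R := by
  have h1 := softMin_lt_left (l := l) hN x i
  have h2 := softMin_lt_right (l := l) hN x i
  linarith

theorem contDiff_softMin [NeZero D] (l : Fin D → ℝ) (N : ℝ) : ContDiff ℝ ∞ (softMin l N) := by
  have hc : ∀ i : Fin D, ContDiff ℝ ∞ fun x : E D => x i := fun i =>
    (EuclideanSpace.proj i : E D →L[ℝ] ℝ).contDiff
  have hs : ContDiff ℝ ∞ (expSum l N) := by
    unfold expSum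
    exact ContDiff.sum fun i _ => ((contDiff_const.mul (hc i)).neg.exp).add
      ((contDiff_const.mul (contDiff_const.sub (hc i))).neg.exp)
  exact ((hs.log fun x => (expSum_pos l N x).ne').div_const N).neg

theorem expSum_le_exp_mul (hN : 0 < N) (l : Fin D → ℝ) (x y : E D) :
    expSum l N x ≤ Real.exp (N * dist x y) * expSum l N y := by
  rw [expSum, expSum, Finset.mul_sum]
  refine Finset.sum_le_sum fun i _ => ?_
  have h : |x i - y i| ≤ dist x y := by
    rw [dist_eq_norm]
    exact PiLp.norm_apply_le (x - y) i
  rw [abs_le] at h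
  rw [mul_add, ← Real.exp_add, ← Real.exp_add]
  refine add_le_add (Real.exp_le_exp.2 ?_) (Real.exp_le_exp.2 ?_) <;> nlinarith

/-- Moving the point by `δ` multiplies each exponential by at most `exp (N δ)`. The constant `1` is
sharp enough to keep the gradient bound of the exact distance. -/
theorem lipschitzWith_softMin [NeZero D] (hN : 0 < N) (l : Fin D → ℝ) :
    LipschitzWith 1 (softMin l N) := by
  refine LipschitzWith.of_le_add fun x y => ?_
  have h := Real.log_le_log (expSum_pos l N y) (expSum_le_exp_mul hN l y x)
  rw [Real.log_mul (Real.exp_pos _).ne' (expSum_pos l N x).ne', Real.log_exp, dist_comm] at h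
  have h2 : Real.log (expSum l N y) / N ≤ dist x y + Real.log (expSum l N x) / N := by
    rw [add_div' _ _ _ hN.ne', div_le_div_iff_of_pos_right hN]; linarith
  simp only [softMin]
  linarith

theorem lt_faceDist_iff [NeZero D] {t : ℝ} {x : E D} :
    t < faceDist l x ↔ ∀ i, t < x i ∧ t < l i - x i := by
  simp [faceDist, Finset.lt_inf'_iff]

theorem faceDist_pos_iff [NeZero D] {x : E D} : 0 < faceDist l x ↔ x ∈ box l := by
  rw [lt_faceDist_iff]
  exact forall_congr' fun i => and_congr_right fun _ => sub_pos

theorem continuous_faceDist [NeZero D] (l : Fin D → ℝ) : Continuous (faceDist l) := by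
  unfold faceDist
  exact Continuous.finset_inf'_apply _ fun i _ =>
    (continuous_coord i).min (continuous_const.sub (continuous_coord i))

theorem faceDist_le [NeZero D] (x : E D) {i : Fin D} {R : ℝ} (hi : l i = 2 * R) :
    faceDist l x ≤ R := by
  by_contra! h
  have := lt_faceDist_iff.1 h i
  linarith

theorem softMin_le_faceDist [NeZero D] (hN : 0 < N) (x : E D) : softMin l N x ≤ faceDist l x :=
  Finset.le_inf' _ _ fun i _ => le_min (softMin_lt_left hN x i).le (softMin_lt_right hN x i).le

/-- Each of the `2D` exponentials is at most `exp (-N d)`, with `d` the smallest face distance. -/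
theorem faceDist_sub_le_softMin [NeZero D] (hN : 0 < N) (x : E D) :
    faceDist l x - Real.log (2 * D) / N ≤ softMin l N x := by
  have hD : (0 : ℝ) < D := by exact_mod_cast Nat.pos_of_neZero D
  have hle : ∀ i, faceDist l x ≤ min (x i) (l i - x i) := fun i =>
    Finset.inf'_le _ (Finset.mem_univ i)
  have h1 : expSum l N x ≤ 2 * D * Real.exp (-(N * faceDist l x)) := by
    have : expSum l N x ≤ ∑ _i : Fin D, 2 * Real.exp (-(N * faceDist l x)) := by
      refine Finset.sum_le_sum fun i _ => ?_
      rw [two_mul]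
      have := le_min_iff.1 (hle i)
      refine add_le_add (Real.exp_le_exp.2 ?_) (Real.exp_le_exp.2 ?_) <;> nlinarith
    refine this.trans (le_of_eq ?_)
    simp; ring
  have h2 := Real.log_le_log (expSum_pos l N x) h1
  rw [Real.log_mul (by positivity) (Real.exp_pos _).ne', Real.log_exp] at h2
  have h3 : Real.log (expSum l N x) / N ≤ Real.log (2 * D) / N - faceDist l x := by
    rw [div_sub' hN.ne', div_le_div_iff_of_pos_right hN]; linarith
  rw [softMin]; linarith

theorem tendsto_softMin [NeZero D] (l : Fin D → ℝ) (x : E D) :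
    Tendsto (fun n : ℕ => softMin l ((n : ℝ) + 1) x) atTop (𝓝 (faceDist l x)) := by
  have h : Tendsto (fun n : ℕ => faceDist l x - Real.log (2 * D) / ((n : ℝ) + 1)) atTop
      (𝓝 (faceDist l x)) := by
    simpa [div_eq_mul_inv] using
      (tendsto_one_div_add_atTop_nhds_zero_nat.const_mul (Real.log (2 * D))).const_sub
        (faceDist l x)
  exact tendsto_of_tendsto_of_tendsto_of_le_of_le h tendsto_const_nhds
    (fun n => faceDist_sub_le_softMin (by positivity) x)
    fun n => softMin_le_faceDist (by positivity) x

end SoftMin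

/-! ### A smooth cutoff near zero. -/

section Ramp

/-- A smooth function that vanishes on `(-∞, 1]` and is the identity on `[2, ∞)`. -/
def ramp (s : ℝ) : ℝ := s * Real.smoothTransition (s - 1)

theorem contDiff_ramp : ContDiff ℝ ∞ ramp :=
  contDiff_id.mul (Real.smoothTransition.contDiff.comp (contDiff_id.sub contDiff_const))

theorem ramp_of_le_one {s : ℝ} (h : s ≤ 1) : ramp s = 0 := by
  rw [ramp, Real.smoothTransition.zero_of_nonpos (by linarith), mul_zero]

theorem ramp_of_two_le {s : ℝ} (h : 2 ≤ s) : ramp s = s := by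
  rw [ramp, Real.smoothTransition.one_of_one_le (by linarith), mul_one]

theorem ramp_nonneg (s : ℝ) : 0 ≤ ramp s := by
  rcases le_total s 1 with h | h
  · exact (ramp_of_le_one h).ge
  · exact mul_nonneg (by linarith) (Real.smoothTransition.nonneg _)

theorem ramp_le_max (s : ℝ) : ramp s ≤ max s 0 := by
  rcases le_total s 1 with h | h
  · rw [ramp_of_le_one h]; exact le_max_right _ _
  · exact (mul_le_of_le_one_right (by linarith) (Real.smoothTransition.le_one _)).trans
      (le_max_left _ _)

theorem deriv_ramp_of_lt_one {s : ℝ} (h : s < 1) : deriv ramp s = 0 := by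
  have : ramp =ᶠ[𝓝 s] fun _ => 0 := by
    filter_upwards [gt_mem_nhds h] with y hy using ramp_of_le_one (le_of_lt hy)
  rw [this.deriv_eq, deriv_const]

theorem deriv_ramp_of_two_lt {s : ℝ} (h : 2 < s) : deriv ramp s = 1 := by
  have : ramp =ᶠ[𝓝 s] fun y => y := by
    filter_upwards [lt_mem_nhds h] with y hy using ramp_of_two_le (le_of_lt hy)
  rw [this.deriv_eq, deriv_id'']

theorem continuous_deriv_ramp : Continuous (deriv ramp) :=
  contDiff_ramp.continuous_deriv (by exact_mod_cast le_top)

theorem exists_abs_deriv_ramp_le : ∃ C : ℝ, ∀ s, |deriv ramp s| ≤ C := by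
  obtain ⟨C, hC⟩ := (isCompact_Icc (a := (1 : ℝ)) (b := 2)).exists_bound_of_continuousOn
    continuous_deriv_ramp.continuousOn
  refine ⟨max C 1, fun s => ?_⟩
  rcases lt_or_ge s 1 with h | h
  · rw [deriv_ramp_of_lt_one h]; simp
  rcases lt_or_ge 2 s with h' | h'
  · rw [deriv_ramp_of_two_lt h']; simp
  · exact (hC s ⟨h, h'⟩).trans (le_max_left _ _)

end Ramp


/-! ### Trial functions and the resulting lower inequality for the torsion. -/

section Trial

variable {l : Fin D → ℝ} {N R p q lam : ℝ}

/-- A smooth approximation, vanishing near the boundary of the box, of `faceDist`. -/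
def cutDist (l : Fin D → ℝ) (N : ℝ) (x : E D) : ℝ := ramp (N * softMin l N x) / N

theorem cutDist_nonneg (hN : 0 < N) (x : E D) : 0 ≤ cutDist l N x :=
  div_nonneg (ramp_nonneg _) hN.le

theorem cutDist_lt (hN : 0 < N) (hR : 0 < R) {i : Fin D} (hi : l i = 2 * R) (x : E D) :
    cutDist l N x < R := by
  have h := softMin_lt hN x hi
  rw [cutDist, div_lt_iff₀ hN]
  refine (ramp_le_max _).trans_lt (max_lt ?_ (by positivity))
  nlinarith

theorem cutDist_eq_zero (hN : 0 < N) {x : E D} (h : softMin l N x ≤ 1 / N) :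
    cutDist l N x = 0 := by
  rw [le_div_iff₀ hN] at h
  rw [cutDist, ramp_of_le_one (by linarith), zero_div]

/-- A bound independent of `N` and `x`, serving as the dominating constant as `N → ∞`. -/
theorem norm_gradient_bound_le (hN : 0 < N) (hR : 0 < R) {i : Fin D} (hi : l i = 2 * R)
    (hp : 0 ≤ p) (hq : 1 ≤ q) (hlam : 0 ≤ lam) {C : ℝ} (hC : ∀ s, |deriv ramp s| ≤ C) (x : E D) :
    ‖(lam * (R - cutDist l N x) ^ (q - 1) * |deriv ramp (N * softMin l N x)|) ^ p‖
      ≤ (lam * R ^ (q - 1) * C) ^ p := by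
  have h0 : 0 ≤ R - cutDist l N x := (sub_pos.2 (cutDist_lt hN hR hi x)).le
  have h1 : (R - cutDist l N x) ^ (q - 1) ≤ R ^ (q - 1) :=
    Real.rpow_le_rpow h0 (by linarith [cutDist_nonneg (l := l) hN x]) (by linarith)
  rw [Real.norm_of_nonneg (by positivity)]
  refine Real.rpow_le_rpow (by positivity) ?_ hp
  exact mul_le_mul (mul_le_mul_of_nonneg_left h1 hlam) (hC _) (abs_nonneg _) (by positivity)

variable [NeZero D]

theorem contDiff_cutDist (l : Fin D → ℝ) (N : ℝ) : ContDiff ℝ ∞ (cutDist l N) :=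
  (contDiff_ramp.comp (contDiff_const.mul (contDiff_softMin l N))).div_const N

theorem norm_fderiv_cutDist_le (hN : 0 < N) (x : E D) :
    ‖fderiv ℝ (cutDist l N) x‖ ≤ |deriv ramp (N * softMin l N x)| := by
  have h1 : HasFDerivAt (softMin l N) (fderiv ℝ (softMin l N) x) x :=
    ((contDiff_softMin l N).differentiable (by simp) x).hasFDerivAt
  have h2 : HasDerivAt ramp (deriv ramp (N * softMin l N x)) (N * softMin l N x) :=
    (contDiff_ramp.differentiable (by simp) _).hasDerivAt
  have h3 := (h2.comp_hasFDerivAt x (h1.const_mul N)).mul_const N⁻¹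
  have h4 : fderiv ℝ (cutDist l N) x
      = deriv ramp (N * softMin l N x) • fderiv ℝ (softMin l N) x := by
    have h5 : HasFDerivAt (cutDist l N) _ x := h3
    rw [h5.fderiv, smul_smul, smul_smul]
    congr 1
    field_simp
  rw [h4, norm_smul, Real.norm_eq_abs]
  refine mul_le_of_le_one_right (abs_nonneg _) ?_
  simpa using norm_fderiv_le_of_lipschitz ℝ (lipschitzWith_softMin hN l) (x₀ := x)

/-- At a fixed interior point `N * softMin` tends to infinity, so it eventually lies where `ramp` is
the identity. -/
theorem tendsto_cutDist {x : E D} (hx : x ∈ box l) :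
    Tendsto (fun n : ℕ => cutDist l ((n : ℝ) + 1) x) atTop (𝓝 (faceDist l x)) ∧
    Tendsto (fun n : ℕ => deriv ramp (((n : ℝ) + 1) * softMin l ((n : ℝ) + 1) x)) atTop (𝓝 1) := by
  have hd : 0 < faceDist l x := faceDist_pos_iff.2 hx
  have h1 := tendsto_softMin l x
  have h2 : Tendsto (fun n : ℕ => ((n : ℝ) + 1) * softMin l ((n : ℝ) + 1) x) atTop atTop :=
    (tendsto_atTop_add_const_right _ _ tendsto_natCast_atTop_atTop).atTop_mul_pos hd h1
  have h3 := h2.eventually (eventually_gt_atTop 2)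
  constructor
  · refine h1.congr' (h3.mono fun n hn => ?_)
    simp only [cutDist, ramp_of_two_le hn.le]
    exact (mul_div_cancel_left₀ _ (by positivity)).symm
  · exact tendsto_const_nhds.congr' (h3.mono fun n hn => (deriv_ramp_of_two_lt hn).symm)

/-- The one-dimensional torsion profile of width `2R`, up to a constant factor. -/
def profile (R q s : ℝ) : ℝ := (R ^ q - (R - s) ^ q) / q

theorem isTestFunction_profile_cutDist (hN : 0 < N) (hR : 0 < R) {i : Fin D} (hi : l i = 2 * R)
    (q lam : ℝ) : IsTestFunction (box l) fun x => lam * profile R q (cutDist l N x) := by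
  set K : Set (E D) := {x | ∀ i, 1 / N ≤ x i ∧ x i ≤ l i - 1 / N}
  have hK : IsCompact K := isCompact_setOf_forall_le_le (fun _ => 1 / N) fun i => l i - 1 / N
  have hz : ∀ x, x ∉ K → lam * profile R q (cutDist l N x) = 0 := by
    intro x hx
    rw [cutDist_eq_zero hN, profile, sub_zero, sub_self, zero_div, mul_zero]
    by_contra! h
    refine hx fun j => ⟨(h.trans (softMin_lt_left hN x j)).le, ?_⟩
    linarith [h.trans (softMin_lt_right hN x j)]
  refine ⟨?_, HasCompactSupport.intro hK hz, ?_⟩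
  · refine contDiff_const.mul ((contDiff_const.sub ?_).div_const q)
    -- The strict inequality `cutDist < R` keeps the base positive, so the real power is smooth.
    exact (contDiff_const.sub (contDiff_cutDist l N)).rpow_const_of_ne
      fun x => (sub_pos.2 (cutDist_lt hN hR hi x)).ne'
  · refine (closure_minimal (fun x hx => ?_) hK.isClosed).trans fun x hx j => ?_
    · by_contra h
      exact hx (hz x h)
    · have hN' : 0 < 1 / N := by positivity
      constructor <;> linarith [(hx j).1, (hx j).2]

theorem norm_gradient_profile_cutDist_le (hN : 0 < N) (hR : 0 < R) {i : Fin D}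
    (hi : l i = 2 * R) (hq : 1 < q) (hlam : 0 ≤ lam) (x : E D) :
    ‖gradient (fun x => lam * profile R q (cutDist l N x)) x‖
      ≤ lam * (R - cutDist l N x) ^ (q - 1) * |deriv ramp (N * softMin l N x)| := by
  have hpos : 0 < R - cutDist l N x := sub_pos.2 (cutDist_lt hN hR hi x)
  have h1 : HasFDerivAt (cutDist l N) (fderiv ℝ (cutDist l N) x) x :=
    ((contDiff_cutDist l N).differentiable (by simp) x).hasFDerivAt
  have h2 : HasDerivAt (fun s => lam * profile R q s)
      (lam * (R - cutDist l N x) ^ (q - 1)) (cutDist l N x) := by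
    have h3 := (((hasDerivAt_id (cutDist l N x)).const_sub R).rpow_const (p := q)
      (Or.inl hpos.ne')).const_sub (R ^ q)
    refine ((h3.div_const q).const_mul lam).congr_deriv ?_
    simp only [id]
    field_simp
  have h4 : HasFDerivAt (fun x => lam * profile R q (cutDist l N x)) _ x :=
    h2.comp_hasFDerivAt x h1
  rw [norm_gradient, h4.fderiv, norm_smul, Real.norm_of_nonneg
    (by positivity)]
  exact mul_le_mul_of_nonneg_left (norm_fderiv_cutDist_le hN x) (by positivity)

theorem profile_nonneg (hq : 0 < q) {s : ℝ} (h0 : 0 ≤ s) (h1 : s ≤ R) : 0 ≤ profile R q s :=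
  div_nonneg (sub_nonneg.2 (Real.rpow_le_rpow (by linarith) (by linarith) hq.le)) hq.le

theorem profile_le (hq : 0 < q) {s : ℝ} (h1 : s ≤ R) : profile R q s ≤ R ^ q / q :=
  div_le_div_of_nonneg_right (by linarith [Real.rpow_nonneg (show 0 ≤ R - s by linarith) q]) hq.le

theorem continuous_profile (R : ℝ) (hq : 0 < q) : Continuous (profile R q) :=
  (continuous_const.sub ((continuous_const.sub continuous_id).rpow_const
    fun _ => Or.inr hq.le)).div_const q

theorem integrable_profile_faceDist {i : Fin D} (hi : l i = 2 * R) (hq : 0 < q) :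
    Integrable (fun x => profile R q (faceDist l x)) (volume.restrict (box l)) := by
  have := isFiniteMeasure_restrict_box l
  refine Integrable.of_bound ((continuous_profile R hq).comp
    (continuous_faceDist l)).aestronglyMeasurable (R ^ q / q) ?_
  refine (ae_restrict_iff' (measurableSet_box l)).2 (ae_of_all _ fun x hx => ?_)
  rw [Real.norm_of_nonneg (profile_nonneg hq (faceDist_pos_iff.2 hx).le (faceDist_le x hi))]
  exact profile_le hq (faceDist_le x hi)

theorem tendsto_integral_trial (hR : 0 < R) {i : Fin D} (hi : l i = 2 * R) (hq : 1 < q)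
    (lam : ℝ) :
    Tendsto (fun n : ℕ => ∫ x in box l, lam * profile R q (cutDist l ((n : ℝ) + 1) x)) atTop
      (𝓝 (∫ x in box l, lam * profile R q (faceDist l x))) := by
  have := isFiniteMeasure_restrict_box l
  have hq0 : 0 < q := by linarith
  refine tendsto_integral_of_dominated_convergence (fun _ => |lam| * (R ^ q / q)) (fun n => ?_)
    (integrable_const _) (fun n => ae_of_all _ fun x => ?_)
    ((ae_restrict_iff' (measurableSet_box l)).2 (ae_of_all _ fun x hx => ?_))
  · exact (continuous_const.mul ((continuous_profile R hq0).comp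
      (contDiff_cutDist l _).continuous)).aestronglyMeasurable
  · have hn : (0 : ℝ) < n + 1 := by positivity
    have h := (cutDist_lt hn hR hi x).le
    rw [norm_mul, Real.norm_eq_abs, Real.norm_of_nonneg
      (profile_nonneg hq0 (cutDist_nonneg hn x) h)]
    exact mul_le_mul_of_nonneg_left (profile_le hq0 h) (abs_nonneg _)
  · exact (((continuous_profile R hq0).tendsto _).comp (tendsto_cutDist hx).1).const_mul lam

theorem continuous_gradient_bound (hp : 0 ≤ p) (hq : 1 ≤ q) (N R lam : ℝ) :
    Continuous fun x : E D => (lam * (R - cutDist l N x) ^ (q - 1) *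
      |deriv ramp (N * softMin l N x)|) ^ p := by
  have h1 : Continuous fun x : E D => (R - cutDist l N x) ^ (q - 1) :=
    (continuous_const.sub (contDiff_cutDist l _).continuous).rpow_const
      fun _ => Or.inr (by linarith)
  have h2 : Continuous fun x : E D => |deriv ramp (N * softMin l N x)| :=
    (continuous_deriv_ramp.comp (continuous_const.mul (contDiff_softMin l _).continuous)).abs
  exact ((continuous_const.mul h1).mul h2).rpow_const fun _ => Or.inr hp

theorem tendsto_integral_gradient_bound (hR : 0 < R) {i : Fin D} (hi : l i = 2 * R)
    (hpq : p.HolderConjugate q) (hlam : 0 ≤ lam) :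
    Tendsto (fun n : ℕ => ∫ x in box l, (lam * (R - cutDist l ((n : ℝ) + 1) x) ^ (q - 1) *
        |deriv ramp (((n : ℝ) + 1) * softMin l ((n : ℝ) + 1) x)|) ^ p) atTop
      (𝓝 (∫ x in box l, lam ^ p * (R - faceDist l x) ^ q)) := by
  have := isFiniteMeasure_restrict_box l
  have hp0 : 0 ≤ p := by linarith [hpq.lt]
  have hq1 : 0 ≤ q - 1 := by linarith [hpq.symm.lt]
  obtain ⟨C, hC⟩ := exists_abs_deriv_ramp_le
  refine tendsto_integral_of_dominated_convergence
    (fun _ => (lam * R ^ (q - 1) * C) ^ p) (fun n => ?_)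
    (integrable_const _) (fun n => ae_of_all _ fun x => ?_)
    ((ae_restrict_iff' (measurableSet_box l)).2 (ae_of_all _ fun x hx => ?_))
  · exact (continuous_gradient_bound hp0 hpq.symm.lt.le _ R lam).aestronglyMeasurable
  · exact norm_gradient_bound_le (by positivity) hR hi hp0 hpq.symm.lt.le hlam hC x
  · obtain ⟨h1, h2⟩ := tendsto_cutDist hx
    have h3 := (((((h1.const_sub R).rpow_const (p := q - 1) (Or.inr hq1)).const_mul lam).mul
      h2.abs).rpow_const (p := p) (Or.inr hp0))
    have h0 : 0 ≤ R - faceDist l x := sub_nonneg.2 (faceDist_le x hi)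
    rw [abs_one, mul_one, Real.mul_rpow hlam (by positivity), ← Real.rpow_mul h0,
      hpq.symm.sub_one_mul_conj] at h3
    exact h3

/-- The limit `N → ∞` of the Young inequality for the trial functions. The profile has derivative
`(R-s)^(q-1)`, whose `p`-th power is `(R-s)^q = R^q - q · profile`; both terms thus involve the same
integral. -/
theorem IsTorsionFunction.integral_profile_le (hpq : p.HolderConjugate q) {u : E D → ℝ}
    (hu : IsTorsionFunction p (box l) u) (hR : 0 < R) {i : Fin D} (hi : l i = 2 * R)
    (hlam : 0 ≤ lam) :
    lam * ∫ x in box l, profile R q (faceDist l x) ≤ (∫ x in box l, u x) / q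
      + lam ^ p * (R ^ q * volume.real (box l) - q * ∫ x in box l, profile R q (faceDist l x)) / p
      := by
  have := isFiniteMeasure_restrict_box l
  have hp0 : 0 < p := by linarith [hpq.lt]
  have hq := hpq.symm.lt
  have hq0 : 0 < q := by linarith
  obtain ⟨g, -, -, -, hT⟩ := hu.exists_gradient hpq
  have e : ∫ x in box l, lam ^ p * (R - faceDist l x) ^ q
      = lam ^ p * (R ^ q * volume.real (box l) - q * ∫ x in box l, profile R q (faceDist l x)) := by
    have e1 : ∀ x : E D, (R - faceDist l x) ^ q = R ^ q - q * profile R q (faceDist l x) :=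
      fun x => by rw [profile, mul_div_cancel₀ _ hq0.ne']; ring
    simp only [e1]
    rw [integral_const_mul, integral_sub (integrable_const _)
      ((integrable_profile_faceDist hi hq0).const_mul q), integral_const_mul, integral_const]
    simp [mul_comm]
  rw [← integral_const_mul, ← e]
  refine le_of_tendsto_of_tendsto' (tendsto_integral_trial hR hi hq lam)
    (((tendsto_integral_gradient_bound hR hi hpq hlam).div_const p).const_add _) fun n => ?_
  have hn : (0 : ℝ) < n + 1 := by positivity
  have hφ := isTestFunction_profile_cutDist hn hR hi q lam
  refine (hT _ hφ).trans (add_le_add_right (div_le_div_of_nonneg_right ?_ hp0.le) _)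
  refine integral_mono_of_nonneg (ae_of_all _ fun x => by positivity) ?_
    (ae_of_all _ fun x => Real.rpow_le_rpow (norm_nonneg _)
      (norm_gradient_profile_cutDist_le hn hR hi hq hlam x) hp0.le)
  obtain ⟨C, hC⟩ := exists_abs_deriv_ramp_le
  exact Integrable.of_bound
    (continuous_gradient_bound hp0.le hq.le _ R lam).aestronglyMeasurable _
    (ae_of_all _ fun x => norm_gradient_bound_le hn hR hi hp0.le hq.le hlam hC x)

end Trial


/-! ### Lower bound for the integral of the profile by the layer-cake formula. -/

section LayerCake

variable {l : Fin D → ℝ} {R p q : ℝ}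

theorem integral_max_sub_rpow (hq : 1 < q) {s : ℝ} (h0 : 0 ≤ s) (h1 : s ≤ R) :
    ∫ t in (0 : ℝ)..s, max (R - t) 0 ^ (q - 1) = profile R q s := by
  have h : ∫ t in (0 : ℝ)..s, max (R - t) 0 ^ (q - 1) = ∫ t in (0 : ℝ)..s, (R - t) ^ (q - 1) := by
    refine intervalIntegral.integral_congr fun t ht => ?_
    rw [Set.uIcc_of_le h0] at ht
    simp only [max_eq_left (show 0 ≤ R - t by linarith [ht.2])]
  rw [h, intervalIntegral.integral_comp_sub_left (fun t => t ^ (q - 1)) R,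
    integral_rpow (Or.inl (by linarith)), profile]
  simp

theorem volume_lt_faceDist [NeZero D] {t : ℝ} (ht : 0 ≤ t) :
    (volume.restrict (box l)) {x | t < faceDist l x} = ∏ i, ENNReal.ofReal (l i - 2 * t) := by
  rw [Measure.restrict_apply (isOpen_lt continuous_const (continuous_faceDist l)).measurableSet]
  have h : {x | t < faceDist l x} ∩ box l = {x : E D | ∀ i, t < x i ∧ x i < l i - t} := by
    ext x
    simp only [Set.mem_inter_iff, Set.mem_ofPred_eq, lt_faceDist_iff]
    constructor
    · exact fun h i => ⟨(h.1 i).1, by linarith [(h.1 i).2]⟩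
    · exact fun h => ⟨fun i => ⟨(h i).1, by linarith [(h i).2]⟩,
        fun i => ⟨by linarith [(h i).1], by linarith [(h i).2]⟩⟩
  rw [h, volume_setOf_forall_lt_lt]
  refine Finset.prod_congr rfl fun i _ => ?_
  congr 1
  ring

/-- Bernoulli's inequality for each factor, with exponent `2R/l_i ≤ 1`: `(1 - t/R)^(2R/l_i) ≤ 1 -
2t/l_i`. -/
theorem prod_mul_rpow_le_prod_sub (hR : 0 < R) (hl : ∀ i, 2 * R ≤ l i) {t : ℝ}
    (h1 : t ≤ R) :
    (∏ i, l i) * (1 - t / R) ^ (∑ i, 2 * R / l i) ≤ ∏ i, (l i - 2 * t) := by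
  have hl0 : ∀ i, 0 < l i := fun i => lt_of_lt_of_le (by positivity) (hl i)
  have hb : t / R ≤ 1 := (div_le_one hR).2 h1
  have hb0 : 0 ≤ 1 - t / R := by linarith
  rw [Real.rpow_sum_of_nonneg hb0 fun i _ => div_nonneg (by positivity) (hl0 i).le,
    ← Finset.prod_mul_distrib]
  refine Finset.prod_le_prod (fun i _ => mul_nonneg (hl0 i).le (Real.rpow_nonneg hb0 _))
    fun i _ => ?_
  have h := rpow_one_add_le_one_add_mul_self (s := -(t / R)) (by linarith)
    (div_nonneg (by positivity) (hl0 i).le) ((div_le_one (hl0 i)).2 (hl i))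
  rw [← sub_eq_add_neg] at h
  refine (mul_le_mul_of_nonneg_left h (hl0 i).le).trans (le_of_eq ?_)
  have := (hl0 i).ne'
  field_simp
  ring

theorem integral_one_sub_div_rpow_mul {M : ℝ} (hR : 0 < R) (hM : 0 < M) (hq : 1 < q) :
    ∫ t in (0 : ℝ)..R, (1 - t / R) ^ M * (R - t) ^ (q - 1) = R ^ q / (M + q) := by
  have h : ∫ t in (0 : ℝ)..R, (1 - t / R) ^ M * (R - t) ^ (q - 1)
      = ∫ t in (0 : ℝ)..R, (R ^ M)⁻¹ * (R - t) ^ (M + q - 1) := by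
    refine intervalIntegral.integral_congr fun t ht => ?_
    rw [Set.uIcc_of_le hR.le] at ht
    have h0 : 0 ≤ R - t := by linarith [ht.2]
    rw [one_sub_div hR.ne', Real.div_rpow h0 hR.le, add_sub_assoc,
      Real.rpow_add_of_nonneg h0 hM.le (by linarith)]
    ring
  rw [h, intervalIntegral.integral_const_mul,
    intervalIntegral.integral_comp_sub_left (fun t => t ^ (M + q - 1)) R,
    integral_rpow (Or.inl (by linarith)), sub_self, sub_zero, Real.zero_rpow (by linarith),
    sub_add_cancel, sub_zero, Real.rpow_add hR]
  have := (Real.rpow_pos_of_pos hR M).ne'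
  field_simp

theorem le_integral_profile_faceDist [NeZero D] (hR : 0 < R) (hl : ∀ i, 2 * R ≤ l i) {i : Fin D}
    (hi : l i = 2 * R) (hq : 1 < q) :
    volume.real (box l) * R ^ q / (∑ i, 2 * R / l i + q)
      ≤ ∫ x in box l, profile R q (faceDist l x) := by
  have hl0 : ∀ i, 0 < l i := fun i => lt_of_lt_of_le (by positivity) (hl i)
  set M := ∑ i, 2 * R / l i with hM
  have hM0 : 0 < M := Finset.sum_pos (fun i _ => div_pos (by positivity) (hl0 i))
    Finset.univ_nonempty
  have hq0 : 0 < q := by linarith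
  have hpos : ∀ᵐ x ∂volume.restrict (box l), 0 ≤ faceDist l x :=
    (ae_restrict_iff' (measurableSet_box l)).2 (ae_of_all _ fun x hx => (faceDist_pos_iff.2 hx).le)
  have hprof : ∀ᵐ x ∂volume.restrict (box l), 0 ≤ profile R q (faceDist l x) :=
    hpos.mono fun x hx => profile_nonneg hq0 hx (faceDist_le x hi)
  -- The layer-cake formula asks for a nonnegative density on all of `(0, ∞)`; the truncation at `R`
  -- is harmless because the distance never exceeds `R`.
  have hg : Continuous fun t : ℝ => max (R - t) 0 ^ (q - 1) :=
    ((continuous_const.sub continuous_id).max continuous_const).rpow_const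
      fun _ => Or.inr (by linarith)
  have key := lintegral_comp_eq_lintegral_meas_lt_mul (volume.restrict (box l)) hpos
    (continuous_faceDist l).aemeasurable (fun t _ => hg.intervalIntegrable 0 t)
    (ae_of_all _ fun t => by positivity)
  have hL : ∫⁻ x in box l, ENNReal.ofReal (∫ t in (0 : ℝ)..faceDist l x, max (R - t) 0 ^ (q - 1))
      = ENNReal.ofReal (∫ x in box l, profile R q (faceDist l x)) := by
    rw [ofReal_integral_eq_lintegral_ofReal (integrable_profile_faceDist hi hq0) hprof]
    refine lintegral_congr_ae (hpos.mono fun x hx => ?_)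
    simp only [integral_max_sub_rpow hq hx (faceDist_le x hi)]
  have hc : Continuous fun t : ℝ => (1 - t / R) ^ M * (R - t) ^ (q - 1) :=
    ((continuous_const.sub (continuous_id.div_const R)).rpow_const fun _ => Or.inr hM0.le).mul
      ((continuous_const.sub continuous_id).rpow_const fun _ => Or.inr (by linarith))
  have hnn : ∀ t ∈ Set.Ioc 0 R, 0 ≤ (1 - t / R) ^ M * (R - t) ^ (q - 1) := fun t ht => by
    have h1 : t / R ≤ 1 := (div_le_one hR).2 ht.2
    exact mul_nonneg (Real.rpow_nonneg (by linarith) _) (Real.rpow_nonneg (by linarith [ht.2]) _)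
  have hV := volumeReal_box_pos hl0
  have hRt : ENNReal.ofReal (volume.real (box l) * R ^ q / (M + q))
      ≤ ∫⁻ t in Set.Ioi 0, (volume.restrict (box l)) {x | t < faceDist l x}
        * ENNReal.ofReal (max (R - t) 0 ^ (q - 1)) := by
    have e : volume.real (box l) * R ^ q / (M + q) = ∫ t in Set.Ioc 0 R,
        volume.real (box l) * ((1 - t / R) ^ M * (R - t) ^ (q - 1)) := by
      rw [integral_const_mul, ← intervalIntegral.integral_of_le hR.le,
        integral_one_sub_div_rpow_mul hR hM0 hq, mul_div_assoc]
    rw [e, ofReal_integral_eq_lintegral_ofReal]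
    · refine (setLIntegral_mono' measurableSet_Ioc fun t ht => ?_).trans
        (lintegral_mono_set Set.Ioc_subset_Ioi_self)
      have h0 : 0 ≤ R - t := by linarith [ht.2]
      rw [volume_lt_faceDist ht.1.le, max_eq_left h0,
        ← ENNReal.ofReal_prod_of_nonneg fun j _ => by linarith [hl j, ht.2],
        ← ENNReal.ofReal_mul (Finset.prod_nonneg fun j _ => by linarith [hl j, ht.2]), ← mul_assoc]
      refine ENNReal.ofReal_le_ofReal (mul_le_mul_of_nonneg_right ?_ (Real.rpow_nonneg h0 _))
      rw [volumeReal_box hl0]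
      exact prod_mul_rpow_le_prod_sub hR hl ht.2
    · exact (continuous_const.mul hc).integrableOn_Ioc
    · exact (ae_restrict_iff' measurableSet_Ioc).2
        (ae_of_all _ fun t ht => mul_nonneg hV.le (hnn t ht))
  rw [← key, hL] at hRt
  exact (ENNReal.ofReal_le_ofReal_iff (integral_nonneg_of_ae hprof)).1 hRt

end LayerCake

/-! ### Lower bound for the torsional rigidity. -/

section LowerBound

variable {l : Fin D → ℝ} {R p q : ℝ}

/-- Multiplying `h` by `q` and using `q/p = q - 1` gives `T ≥ m (q (M+q-1) I - (q-1) B)`. Inserting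
the bound on `I` turns the right side into `m B M/(M+q)`, which is at least `m B/(q+1)` because `M ≥
1`. -/
theorem le_of_young_le {p q m M B I T : ℝ} (hpq : p.HolderConjugate q) (hm : 0 < m) (hM : 1 ≤ M)
    (hB : 0 ≤ B) (hI : B / (M + q) ≤ I) (h : m * M * I ≤ T / q + m * (B - q * I) / p) :
    m * B / (q + 1) ≤ T := by
  have hq := hpq.symm.lt
  have hp := hpq.lt
  have hMq : 0 < M + q := by linarith
  have hpinv : p⁻¹ = 1 - q⁻¹ := by rw [← hpq.inv_add_inv_eq_one]; ring
  have h1 : q * (m * M * I) ≤ T + m * (B - q * I) * (q - 1) := by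
    have h2 := mul_le_mul_of_nonneg_left h (show 0 ≤ q by linarith)
    rw [div_eq_mul_inv _ p, hpinv] at h2
    have h3 : q * (T / q + m * (B - q * I) * (1 - q⁻¹)) = T + m * (B - q * I) * (q - 1) := by
      field_simp
    rwa [h3] at h2
  have h4 : m * (B / (q + 1)) ≤ m * (q * (M + q - 1) * I - (q - 1) * B) := by
    refine mul_le_mul_of_nonneg_left ?_ hm.le
    have h5 : q * (M + q - 1) * (B / (M + q)) ≤ q * (M + q - 1) * I :=
      mul_le_mul_of_nonneg_left hI (mul_nonneg (by linarith) (by linarith))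
    have h6 : B / (q + 1) ≤ q * (M + q - 1) * (B / (M + q)) - (q - 1) * B := by
      have h7 : q * (M + q - 1) * (B / (M + q)) - (q - 1) * B = B * M / (M + q) := by
        field_simp; ring
      rw [h7, div_le_div_iff₀ (by linarith) hMq]
      nlinarith [mul_nonneg hB (mul_nonneg (show 0 ≤ q by linarith) (sub_nonneg.2 hM))]
    linarith
  have h8 : m * B / (q + 1) = m * (B / (q + 1)) := mul_div_assoc _ _ _
  rw [h8]
  refine h4.trans ?_
  linarith

theorem IsTorsionFunction.le_integral [NeZero D] (hpq : p.HolderConjugate q) {u : E D → ℝ}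
    (hu : IsTorsionFunction p (box l) u) (hR : 0 < R) (hl : ∀ i, 2 * R ≤ l i) {i : Fin D}
    (hi : l i = 2 * R) :
    (∑ i, 2 * R / l i) ^ (-q) * (volume.real (box l) * R ^ q) / (q + 1)
      ≤ ∫ x in box l, u x := by
  have hl0 : ∀ i, 0 < l i := fun i => lt_of_lt_of_le (by positivity) (hl i)
  set M := ∑ i, 2 * R / l i with hM
  have hM1 : 1 ≤ M := by
    have h := Finset.single_le_sum (f := fun i => 2 * R / l i)
      (fun j _ => div_nonneg (by positivity) (hl0 j).le) (Finset.mem_univ i)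
    simpa only [hi, div_self (show 2 * R ≠ 0 by positivity)] using h
  have hM0 : 0 < M := by linarith
  refine le_of_young_le hpq (Real.rpow_pos_of_pos hM0 _) hM1 (by positivity)
    (le_integral_profile_faceDist hR hl hi hpq.symm.lt) ?_
  -- The amplitude is `λ = M^(1-q)`; since `(1-q) p = -q`, it satisfies `λ^p = M^(-q) = m` and `λ =
  -- m M`.
  have h := hu.integral_profile_le hpq hR hi (Real.rpow_nonneg hM0.le (1 - q))
  have e : (1 - q) * p = -q := by have := hpq.symm.sub_one_mul_conj; linarith
  rw [← Real.rpow_mul hM0.le, e, sub_eq_neg_add, Real.rpow_add_one hM0.ne',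
    mul_comm (R ^ q)] at h
  exact h

end LowerBound

/-! ### Bounds for `Q` and for the quotient of its infimum and supremum. -/

section Main

variable {l : Fin D → ℝ} {R κ p : ℝ}

theorem Q_box_mem_Icc (hp : 1 < p) (hκ : 2 ≤ κ) (hD : 2 ≤ D) (h : IsSides κ R l) :
    Q p (box l) ∈ Set.Icc 1 (1 + 2 * ((D : ℝ) - 1) / κ) := by
  have : NeZero D := ⟨by omega⟩
  set q := p / (p - 1) with hq
  have hpq : p.HolderConjugate q := Real.HolderConjugate.conjExponent hp
  have hq1 := hpq.symm.lt
  have hR := h.1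
  have hl := h.two_mul_le hκ
  have hl0 := h.pos hκ
  have h0 : l 0 = 2 * R := h.2.1 0 (by simp)
  have hu : IsTorsionFunction p (box l) (torsionFunction p (box l)) :=
    Classical.epsilon_spec (exists_isTorsionFunction hpq l 0)
  have hup := hu.integral_le hpq hl0 h0
  have hlow := hu.le_integral hpq hR hl h0
  have hV := volumeReal_box_pos hl0
  set M := ∑ i, 2 * R / l i
  have hM0 : 0 < M := Finset.sum_pos (fun i _ => div_pos (by positivity) (hl0 i))
    Finset.univ_nonempty
  set V := volume.real (box l)
  have hQ : Q p (box l) = (V ^ (p - 1) * (∫ x in box l, torsionFunction p (box l) x) ^ (1 - p)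
      * R ^ p / ((2 * p - 1) / (p - 1)) ^ (p - 1)) ^ (1 / p) := by
    rw [Q, normalizedRigidity, torsionalRigidity, h.inradius_box hκ hD]
  set T := ∫ x in box l, torsionFunction p (box l) x
  have hT : 0 < T := lt_of_lt_of_le (by positivity) hlow
  have hp1 : 0 < p - 1 := by linarith
  have hc : (2 * p - 1) / (p - 1) = q + 1 := by rw [hq, div_add_one hp1.ne']; ring
  have hqp : q * (p - 1) = p := by rw [hq]; field_simp
  -- All factors become `(p-1)`-th powers, using `R ^ p = (R ^ q) ^ (p - 1)`.
  have hX : V ^ (p - 1) * T ^ (1 - p) * R ^ p / (q + 1) ^ (p - 1)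
      = (V * R ^ q / (q + 1) / T) ^ (p - 1) := by
    rw [Real.div_rpow (by positivity) hT.le, Real.div_rpow (by positivity) (by positivity),
      Real.mul_rpow hV.le (by positivity), ← Real.rpow_mul hR.le, hqp,
      show 1 - p = -(p - 1) by ring, Real.rpow_neg hT.le]
    field_simp
  rw [hQ, hc, hX]
  set X := V * R ^ q / (q + 1) / T with hXdef
  have hX1 : 1 ≤ X := (one_le_div hT).2 hup
  have hX2 : X ≤ M ^ q := by
    rw [hXdef, div_le_iff₀ hT]
    have h1 := mul_le_mul_of_nonneg_left hlow (Real.rpow_nonneg hM0.le q)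
    rw [Real.rpow_neg hM0.le] at h1
    refine le_trans (le_of_eq ?_) h1
    have := (Real.rpow_pos_of_pos hM0 q).ne'
    field_simp
  have hp0 : 0 < p := by linarith
  refine ⟨Real.one_le_rpow (Real.one_le_rpow hX1 hp1.le) (by positivity), ?_⟩
  refine le_trans ?_ (h.sum_le hκ hD)
  have h1 : X ^ (p - 1) ≤ M ^ p := by
    refine (Real.rpow_le_rpow (by linarith) hX2 hp1.le).trans (le_of_eq ?_)
    rw [← Real.rpow_mul hM0.le, hqp]
  refine (Real.rpow_le_rpow (Real.rpow_nonneg (by linarith) _) h1 (by positivity)).trans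
    (le_of_eq ?_)
  rw [one_div, Real.rpow_rpow_inv hM0.le hp0.ne']

theorem isSides_ite (hR : 0 < R) :
    IsSides κ R fun i : Fin D => if i.val = 0 then 2 * R else κ * R :=
  ⟨hR, fun i hi => by simp [hi], fun i hi => by simp [hi]⟩

theorem le_gammaFamily_orthotopes (hp : 1 < p) (hκ : 2 ≤ κ) (hD : 2 ≤ D) :
    κ / (κ + 2 * ((D : ℝ) - 1)) ≤ gammaFamily (orthotopes D κ) p := by
  -- Nonemptiness matters: the real infimum of the empty set is `0`, which would defeat the bound
  -- below by `1`.
  have hne : (Q p '' orthotopes D κ).Nonempty :=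
    ⟨_, _, ⟨1, _, isSides_ite one_pos, rfl⟩, rfl⟩
  have hmem : ∀ y ∈ Q p '' orthotopes D κ, y ∈ Set.Icc 1 (1 + 2 * ((D : ℝ) - 1) / κ) := by
    rintro _ ⟨_, ⟨R, l, h, rfl⟩, rfl⟩
    exact Q_box_mem_Icc hp hκ hD h
  have hinf : 1 ≤ sInf (Q p '' orthotopes D κ) := le_csInf hne fun y hy => (hmem y hy).1
  have hsup : sSup (Q p '' orthotopes D κ) ≤ 1 + 2 * ((D : ℝ) - 1) / κ :=
    csSup_le hne fun y hy => (hmem y hy).2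
  have hpos : 0 < sSup (Q p '' orthotopes D κ) := by
    obtain ⟨y, hy⟩ := hne
    exact lt_of_lt_of_le (by linarith [(hmem y hy).1])
      (le_csSup ⟨_, fun z hz => (hmem z hz).2⟩ hy)
  have hκ0 : 0 < κ := by linarith
  have e : κ / (κ + 2 * ((D : ℝ) - 1)) = 1 / (1 + 2 * ((D : ℝ) - 1) / κ) := by
    rw [one_add_div hκ0.ne', one_div_div]
  rw [e, gammaFamily]
  exact div_le_div₀ (by linarith) hinf hpos hsup

end Main

end Torsion

end

theorem mainTheorem9 (D : ℕ) (hD : 2 ≤ D) (p : ℝ) (hp : 1 < p) (κ : ℝ) (hκ : 2 ≤ κ) :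
    (∀ (R : ℝ) (l : Fin D → ℝ), Torsion.IsSides κ R l →
      Torsion.inradius (Torsion.box l) = R ∧
      Torsion.perimeter (Torsion.box l) ≠ ⊤ ∧
      R * (Torsion.perimeter (Torsion.box l)).toReal / volume.real (Torsion.box l)
        ≤ 1 + 2 * ((D : ℝ) - 1) / κ) ∧
    κ / (κ + 2 * ((D : ℝ) - 1)) ≤ Torsion.gammaFamily (Torsion.orthotopes D κ) p :=
  ⟨fun _ _ h => ⟨h.inradius_box hκ hD,
      ne_top_of_le_ne_top ENNReal.ofReal_ne_top (Torsion.perimeter_box_le (by omega) (h.pos hκ)),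
      h.perimeter_ratio_le hκ hD⟩,
    Torsion.le_gammaFamily_orthotopes hp hκ hD⟩
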